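/- Let $d\ge 3$ and $r\ge 1$ be integers. For $f\colon[0,1]\to\mathbb R$ put $$\mathcal S_d[f](s)=\int_0^1 f(ts)\,\varrho_d(t)\,\mathrm dt,\quad s\in[0,1],\qquad \varrho_d(t)=\frac{2\Gamma(d/2)}{\sqrt\pi\,\Gamma((d-1)/2)}\,(1-t^2)^{\frac{d-3}{2}}.$$ Let $g_0=1$, $g_k(t)=\sqrt2\cos(\pi kt)$ for $k\ge1$, and for $a=(a_0,\dots,a_{K-1})\in\mathbb R^K$ let $f_a=\sum_{k=0}^{K-1}a_kg_k$. For an integer $n\ge 0$, $H^n$ of an interval denotes the Sobolev space of the functions whose weak derivatives up to order $n$ are in $L^2$, and $\|u\|_{H^1}^2=\|u\|_{L^2}^2+\|u'\|_{L^2}^2$. Assume that $F=\mathcal S_d[f]$ almost everywhere on $[0,1]$ for some $f\colon[0,1]\to\mathbb R$ with $f(|\cdot|)\in H^r([-1,1])$. Let $\mathcal H$ be $L^2([0,1])$ or $H^1([0,1])$. For every integer $K\ge1$ the problem $$\min_{a\in\mathbb R^K}\|\mathcal S_d[f_a]-F\|_{\mathcal H}^2$$ has a unique minimizer $a=a(K,\mathcal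 H)$, and $F-\mathcal S_d[f_a]\in\mathcal H$. Moreover: (i) If $\mathcal H=L^2([0,1])$, there is a constant $C>0$ independent of $K$ such that for all integers $K\ge1$ $$\|F-\mathcal S_d[f_a]\|_{L^2([0,1])}\le C\,K^{-\frac{r}{1+2r/(d-1)}}.$$ (ii) If $\mathcal H=H^1([0,1])$, there is a constant $C>0$ independent of $K$ such that for all integers $K\ge1$ $$\|F-\mathcal S_d[f_a]\|_{H^1([0,1])}\le C\,K^{-\frac{(r-1)(d-3)}{d-3+2r}}.$$ For $d>3$ the exponent in (ii) equals $-\frac{r-1}{1+2r/(d-3)}$; for $d=3$ it is $0$. -/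

import Mathlib

open MeasureTheory
open scoped ContDiff

noncomputable section

namespace Slicing

/-- The normalising constant `c_d = 2 Γ(d/2) / (√π Γ((d-1)/2))`. -/
def normConst (d : ℕ) : ℝ :=
  2 * Real.Gamma ((d : ℝ) / 2) / (Real.sqrt Real.pi * Real.Gamma (((d : ℝ) - 1) / 2))

/-- The density `ϱ_d(t) = c_d (1 - t²)^((d-3)/2)` on `[0,1]`. -/
def density (d : ℕ) (t : ℝ) : ℝ :=
  normConst d * (1 - t ^ 2) ^ (((d : ℝ) - 3) / 2)

/-- The slicing operator `S_d[f](s) = ∫₀¹ f(ts) ϱ_d(t) dt`. For `s ∈ [0,1]` it only involves the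
values of `f` on `[0,1]`. -/
def slicing (d : ℕ) (f : ℝ → ℝ) (s : ℝ) : ℝ :=
  ∫ t in (0 : ℝ)..1, f (t * s) * density d t

/-- The cosine basis `g_0 = 1`, `g_k(t) = √2 cos(π k t)` for `k ≥ 1`. -/
def cosBasis (k : ℕ) (t : ℝ) : ℝ :=
  if k = 0 then 1 else Real.sqrt 2 * Real.cos (Real.pi * k * t)

/-- The `K`-term cosine sum `f_a = ∑_{k=0}^{K-1} a_k g_k`. -/
def cosSum {K : ℕ} (a : Fin K → ℝ) (t : ℝ) : ℝ :=
  ∑ k : Fin K, a k * cosBasis k t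

/-- `v` is a `k`-th weak derivative of `u` on the open interval `(a,b)`. -/
def HasWeakDeriv (a b : ℝ) (k : ℕ) (u v : ℝ → ℝ) : Prop :=
  LocallyIntegrableOn u (Set.Ioo a b) ∧ LocallyIntegrableOn v (Set.Ioo a b) ∧
    ∀ φ : ℝ → ℝ, ContDiff ℝ ∞ φ → HasCompactSupport φ → tsupport φ ⊆ Set.Ioo a b →
      ∫ x in Set.Ioo a b, u x * iteratedDeriv k φ x =
        (-1) ^ k * ∫ x in Set.Ioo a b, v x * φ x

/-- `u ∈ H^n([a,b])`: `u` and its weak derivatives up to order `n` exist in `L²`. -/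
def MemSobolev (a b : ℝ) (n : ℕ) (u : ℝ → ℝ) : Prop :=
  MemLp u 2 (volume.restrict (Set.Ioo a b)) ∧
    ∀ k : ℕ, k ≤ n → ∃ v : ℝ → ℝ,
      MemLp v 2 (volume.restrict (Set.Ioo a b)) ∧ HasWeakDeriv a b k u v

open Classical in
/-- The first weak derivative on `(a,b)` (unique up to null sets); `0` if there is none. -/
def weakDeriv (a b : ℝ) (u : ℝ → ℝ) : ℝ → ℝ :=
  if h : ∃ v, HasWeakDeriv a b 1 u v then h.choose else 0

/-- The norm of `L²([0,1])` (meaningful for `u ∈ L²([0,1])`). -/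
def l2Norm (u : ℝ → ℝ) : ℝ :=
  Real.sqrt (∫ x in Set.Ioo (0 : ℝ) 1, u x ^ 2)

/-- The norm of `H¹([0,1])` (meaningful for `u ∈ H¹([0,1])`). -/
def h1Norm (u : ℝ → ℝ) : ℝ :=
  Real.sqrt ((∫ x in Set.Ioo (0 : ℝ) 1, u x ^ 2) +
    ∫ x in Set.Ioo (0 : ℝ) 1, weakDeriv 0 1 u x ^ 2)

/-- `a` solves `argmin_{a ∈ ℝ^K} ‖S_d[f_a] - F‖²` for the norm `N`. -/
def IsMinimizer (N : (ℝ → ℝ) → ℝ) (d : ℕ) (F : ℝ → ℝ) {K : ℕ} (a : Fin K → ℝ) : Prop :=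
  ∀ b : Fin K → ℝ,
    N (fun s => slicing d (cosSum a) s - F s) ^ 2 ≤
      N (fun s => slicing d (cosSum b) s - F s) ^ 2

end Slicing

end

/-! The slicing operator averages the dilates `g (t * s)` against a weight that vanishes at `t = 1`
to order `(d-3)/2` (and is merely bounded if `d = 3`). It therefore barely sees what `g` does near
the endpoint `1`. If `g` vanishes on `(0, 1-ε)`, then only `t ≥ 1-ε` contribute, where the weight is
`O(ε^((d-3)/2))`. This range has length `ε`, so the `L²` norm of the average is `O(ε^((d-1)/2))`
times that of `g` (`integral_dilAvg_sq_le_of_support`).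

The even function `u = f |·|` is in `H^r(-1,1)`, but its 2-periodic extension need not have `r`
derivatives at `±1`, so its cosine series may converge slowly. Multiplying `u` by a cutoff `χ` that
equals `1` up to distance `ε` from `±1` repairs this. The product is in `H^r` of the circle, with
`r`-th derivative `O(ε^(-r))` in `L²`. By Parseval its cosine sum with `K` terms has error `O(ε^(-r)
K^(-r))`, and `O(ε^(-r) K^(-(r-1)))` for the first derivative (`exists_modification`,
`exists_cosSum_approx`). The change `χ u - u` lives near `1` and is `O(1)` in `L²`, its derivative
`O(ε⁻¹)`; slicing turns these into `O(ε^((d-1)/2))` and `O(ε^((d-3)/2))`. The derivative is covered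
because differentiating an average differentiates `g` and multiplies the weight by `t ≤ 1`
(`hasWeakDeriv_dilAvg`).

The minimizer is at least as good as this trial sum (`exists_trial`), and choosing `ε` as a power of
`K` that equates the two errors gives both rates (`le_rpow_of_balance`).

Existence and uniqueness are linear least squares, once the sliced basis functions are independent.
If the average of a cosine sum vanishes, so do all its derivatives at `0`, and a Vandermonde
argument kills the coefficients (`eq_zero_of_dilAvg_cosSum`). -/

namespace Slicing

open Set ENNReal

/-! ### Averages of dilates: bounds in `L²` -/

/-- The average `∫₀¹ g(ts) w(t) dt` of the dilates of `g` with weight `w`. -/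
noncomputable def dilAvg (w g : ℝ → ℝ) (s : ℝ) : ℝ := ∫ t in (0 : ℝ)..1, g (t * s) * w t

/-- Lebesgue measure on the open unit interval. -/
noncomputable abbrev unitVol : Measure ℝ := volume.restrict (Ioo (0 : ℝ) 1)

lemma dilAvg_eq_setIntegral (w g : ℝ → ℝ) (s : ℝ) :
    dilAvg w g s = ∫ t, g (t * s) * w t ∂unitVol := by
  rw [dilAvg, intervalIntegral.integral_of_le zero_le_one, integral_Ioc_eq_integral_Ioo]

/-- The image measure is `s⁻¹` times Lebesgue measure on `(0,s)`, and `(0,s) ⊆ (0,1)`. Through this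
bound, null sets and `L²` membership pass to dilates. -/
lemma map_mul_unitVol_le {s : ℝ} (hs : s ∈ Ioo (0 : ℝ) 1) :
    Measure.map (· * s) unitVol ≤ ENNReal.ofReal s⁻¹ • unitVol := by
  have hs0 : s ≠ 0 := hs.1.ne'
  have h1 : Ioo (0 : ℝ) 1 = (Homeomorph.mulRight₀ s hs0).toMeasurableEquiv ⁻¹' Ioo 0 s := by
    ext t
    simp only [Homeomorph.toMeasurableEquiv_coe, mem_preimage, mem_Ioo, Homeomorph.coe_mulRight₀]
    constructor
    · rintro ⟨h, h'⟩
      exact ⟨mul_pos h hs.1, by nlinarith [hs.1]⟩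
    · rintro ⟨h, h'⟩
      exact ⟨pos_of_mul_pos_left h hs.1.le, by nlinarith [hs.1]⟩
  have h2 : Measure.map (· * s) unitVol
      = Measure.map (Homeomorph.mulRight₀ s hs0).toMeasurableEquiv unitVol := rfl
  rw [h2, unitVol]
  nth_rewrite 1 [h1]
  rw [← MeasurableEquiv.restrict_map]
  have h3 : Measure.map (Homeomorph.mulRight₀ s hs0).toMeasurableEquiv volume
      = ENNReal.ofReal |s⁻¹| • volume := Real.map_volume_mul_right hs0
  rw [h3, Measure.restrict_smul, abs_of_pos (inv_pos.2 hs.1)]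
  gcongr
  exact hs.2.le

lemma ae_comp_mul {p : ℝ → Prop} (h : ∀ᵐ x ∂unitVol, p x) {s : ℝ} (hs : s ∈ Ioo (0 : ℝ) 1) :
    ∀ᵐ t ∂unitVol, p (t * s) := by
  have h1 : ∀ᵐ x ∂(Measure.map (· * s) unitVol), p x :=
    Measure.ae_mono' ((Measure.absolutelyContinuous_of_le (map_mul_unitVol_le hs)).trans
      Measure.smul_absolutelyContinuous) h
  exact ae_of_ae_map (by fun_prop) h1

lemma dilAvg_congr {w g g' : ℝ → ℝ} (h : g =ᵐ[unitVol] g') {s : ℝ} (hs : s ∈ Ioo (0 : ℝ) 1) :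
    dilAvg w g s = dilAvg w g' s := by
  rw [dilAvg_eq_setIntegral, dilAvg_eq_setIntegral]
  refine integral_congr_ae ?_
  filter_upwards [ae_comp_mul h hs] with t ht
  rw [ht]

lemma memLp_comp_mul {g : ℝ → ℝ} (hg : MemLp g 2 unitVol) {s : ℝ} (hs : s ∈ Ioo (0 : ℝ) 1) :
    MemLp (fun t => g (t * s)) 2 unitVol := by
  have h1 : MemLp g 2 (Measure.map (· * s) unitVol) :=
    hg.of_measure_le_smul ENNReal.ofReal_ne_top (map_mul_unitVol_le hs)
  exact h1.comp_of_map (by fun_prop)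

lemma lintegral_comp_mul_le (φ : ℝ → ℝ≥0∞) {s : ℝ} (hs : s ∈ Ioo (0 : ℝ) 1) :
    ∫⁻ t, φ (t * s) ∂unitVol ≤ ENNReal.ofReal s⁻¹ * ∫⁻ x, φ x ∂unitVol := by
  have he : MeasurableEmbedding (fun t : ℝ => t * s) :=
    (Homeomorph.mulRight₀ s hs.1.ne').measurableEmbedding
  rw [← he.lintegral_map]
  calc _ ≤ ∫⁻ x, φ x ∂(ENNReal.ofReal s⁻¹ • unitVol) :=
        lintegral_mono' (map_mul_unitVol_le hs) le_rfl
    _ = _ := by rw [lintegral_smul_measure, smul_eq_mul]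

lemma sq_lintegral_mul_le {α : Type*} [MeasurableSpace α] (μ : Measure α) {f g : α → ℝ≥0∞}
    (hf : AEMeasurable f μ) (hg : AEMeasurable g μ) :
    (∫⁻ a, f a * g a ∂μ) ^ 2 ≤ (∫⁻ a, f a ^ 2 ∂μ) * ∫⁻ a, g a ^ 2 ∂μ := by
  have h := ENNReal.lintegral_mul_le_Lp_mul_Lq μ Real.HolderConjugate.two_two hf hg
  have h2 := pow_le_pow_left₀ (zero_le) h 2
  simp only [Pi.mul_apply, ENNReal.rpow_two] at h2
  refine h2.trans (le_of_eq ?_)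
  rw [mul_pow]
  congr 1 <;> rw [← ENNReal.rpow_two, ← ENNReal.rpow_mul] <;> norm_num

/-- Weighted Cauchy–Schwarz in `t`, then Tonelli. The substitution `x = t s` costs `t⁻¹`, which with
the weight `t^(1/2)` leaves `t^(-1/2)`; hence the integral `J` enters twice. Values `t ≤ δ` do not
contribute, since then `t s < δ`. -/
lemma lintegral_dilAvg_sq_le {w g : ℝ → ℝ} (hg : Measurable g)
    {M δ J : ℝ} (hδ : 0 ≤ δ) (hM : ∀ t ∈ Ioo δ 1, |w t| ≤ M)
    (hg0 : ∀ x ∈ Ioo 0 δ, g x = 0)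
    (hJ : ∫⁻ t in Ioo δ 1, ENNReal.ofReal (t ^ (-(1 / 2) : ℝ)) ≤ ENNReal.ofReal J) :
    ∫⁻ s, ‖dilAvg w g s‖ₑ ^ 2 ∂unitVol ≤
      ENNReal.ofReal (M * J) ^ 2 * ∫⁻ x, ‖g x‖ₑ ^ 2 ∂unitVol := by
  rcases le_or_gt 1 δ with hδ1 | hδ1
  · have : ∀ s ∈ Ioo (0 : ℝ) 1, dilAvg w g s = 0 := by
      intro s hs
      rw [dilAvg_eq_setIntegral]
      refine setIntegral_eq_zero_of_forall_eq_zero fun t ht => ?_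
      rw [hg0 _ ⟨mul_pos ht.1 hs.1, by nlinarith [ht.1, ht.2, hs.1, hs.2]⟩, zero_mul]
    rw [setLIntegral_congr_fun (g := fun _ => 0) measurableSet_Ioo]
    · simp
    · intro s hs
      simp [this s hs]
  have hM0 : 0 ≤ M := (abs_nonneg _).trans (hM ((δ + 1) / 2) ⟨by linarith, by linarith⟩)
  set G := ∫⁻ x, ‖g x‖ₑ ^ 2 ∂unitVol
  set ν := volume.restrict (Ioo δ 1)
  set Jl := ∫⁻ t, ENNReal.ofReal (t ^ (-(1 / 2) : ℝ)) ∂ν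
  have hpt : ∀ s ∈ Ioo (0 : ℝ) 1, ‖dilAvg w g s‖ₑ ^ 2 ≤
      ENNReal.ofReal M ^ 2 * (Jl * ∫⁻ t, ‖g (t * s)‖ₑ ^ 2 * ENNReal.ofReal (t ^ (1 / 2 : ℝ)) ∂ν) := by
    intro s hs
    have h1 : ‖dilAvg w g s‖ₑ ≤ ENNReal.ofReal M * ∫⁻ t, ‖g (t * s)‖ₑ ∂ν := by
      rw [dilAvg_eq_setIntegral]
      refine (enorm_integral_le_lintegral_enorm _).trans ?_
      rw [← lintegral_const_mul _ (by fun_prop), unitVol, ← lintegral_indicator measurableSet_Ioo,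
        ← lintegral_indicator measurableSet_Ioo]
      refine lintegral_mono_ae ?_
      filter_upwards [Measure.ae_ne volume δ] with t htδ
      by_cases ht : t ∈ Ioo (0 : ℝ) 1
      · rw [indicator_of_mem ht]
        rcases lt_or_gt_of_ne htδ with h | h
        · rw [hg0 (t * s) ⟨mul_pos ht.1 hs.1, by nlinarith [ht.1, hs.2]⟩]
          simp
        · have ht' : t ∈ Ioo δ 1 := ⟨h, ht.2⟩
          rw [indicator_of_mem ht', enorm_mul, mul_comm]
          gcongr
          rw [← ofReal_norm]
          exact ENNReal.ofReal_le_ofReal (hM t ht')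
      · rw [indicator_of_notMem ht]
        exact zero_le
    -- The factor `t^(-1/4) t^(1/4) = 1` is split so that both integrals produced by Cauchy–Schwarz
    -- reduce to that of `t^(-1/2)`.
    have h2 : ∫⁻ t, ‖g (t * s)‖ₑ ∂ν = ∫⁻ t, ENNReal.ofReal (t ^ (-(1 / 4) : ℝ)) *
        (‖g (t * s)‖ₑ * ENNReal.ofReal (t ^ (1 / 4 : ℝ))) ∂ν := by
      refine setLIntegral_congr_fun measurableSet_Ioo fun t ht => ?_
      have ht0 : 0 < t := hδ.trans_lt ht.1
      change _ = ENNReal.ofReal (t ^ (-(1 / 4) : ℝ)) *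
        (‖g (t * s)‖ₑ * ENNReal.ofReal (t ^ (1 / 4 : ℝ)))
      rw [mul_left_comm, ← ENNReal.ofReal_mul (by positivity), ← Real.rpow_add ht0]
      simp
    calc _ ≤ (ENNReal.ofReal M * ∫⁻ t, ‖g (t * s)‖ₑ ∂ν) ^ 2 := by gcongr
      _ = ENNReal.ofReal M ^ 2 * (∫⁻ t, ‖g (t * s)‖ₑ ∂ν) ^ 2 := mul_pow _ _ _
      _ ≤ _ := by
        gcongr
        rw [h2]
        refine (sq_lintegral_mul_le ν (by fun_prop) (by fun_prop)).trans (le_of_eq ?_)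
        congr 1
        · refine setLIntegral_congr_fun measurableSet_Ioo fun t ht => ?_
          have ht0 : 0 < t := hδ.trans_lt ht.1
          change ENNReal.ofReal _ ^ 2 = _
          rw [← ENNReal.ofReal_pow (by positivity), ← Real.rpow_natCast, ← Real.rpow_mul ht0.le]
          norm_num
        · refine setLIntegral_congr_fun measurableSet_Ioo fun t ht => ?_
          have ht0 : 0 < t := hδ.trans_lt ht.1
          change (_ * ENNReal.ofReal _) ^ 2 = _ * _
          rw [mul_pow, ← ENNReal.ofReal_pow (by positivity), ← Real.rpow_natCast (t ^ _),
            ← Real.rpow_mul ht0.le]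
          norm_num
  have hmeas : Measurable (Function.uncurry fun s t : ℝ =>
      ‖g (t * s)‖ₑ ^ 2 * ENNReal.ofReal (t ^ (1 / 2 : ℝ))) := by
    unfold Function.uncurry
    fun_prop
  calc _ ≤ ∫⁻ s, ENNReal.ofReal M ^ 2 *
        (Jl * ∫⁻ t, ‖g (t * s)‖ₑ ^ 2 * ENNReal.ofReal (t ^ (1 / 2 : ℝ)) ∂ν) ∂unitVol :=
        setLIntegral_mono' measurableSet_Ioo hpt
    _ = ENNReal.ofReal M ^ 2 * (Jl * ∫⁻ s, ∫⁻ t, ‖g (t * s)‖ₑ ^ 2 *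
          ENNReal.ofReal (t ^ (1 / 2 : ℝ)) ∂ν ∂unitVol) := by
        have := hmeas.lintegral_prod_right (ν := ν)
        rw [lintegral_const_mul _ (by exact this.const_mul _), lintegral_const_mul _ (by exact this)]
    _ = ENNReal.ofReal M ^ 2 * (Jl * ∫⁻ t, ∫⁻ s, ‖g (t * s)‖ₑ ^ 2 *
          ENNReal.ofReal (t ^ (1 / 2 : ℝ)) ∂unitVol ∂ν) := by
        rw [lintegral_lintegral_swap hmeas.aemeasurable]
    _ ≤ ENNReal.ofReal M ^ 2 * (Jl * ∫⁻ t, ENNReal.ofReal (t ^ (-(1 / 2) : ℝ)) * G ∂ν) := by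
        gcongr ENNReal.ofReal M ^ 2 * (Jl * ?_)
        refine setLIntegral_mono' measurableSet_Ioo fun t ht => ?_
        have ht0 : 0 < t := hδ.trans_lt ht.1
        rw [lintegral_mul_const _ (by fun_prop)]
        have h := lintegral_comp_mul_le (fun x => ‖g x‖ₑ ^ 2) (s := t) ⟨ht0, ht.2⟩
        simp_rw [mul_comm _ t] at h
        calc _ ≤ ENNReal.ofReal t⁻¹ * G * ENNReal.ofReal (t ^ (1 / 2 : ℝ)) := by gcongr
          _ = _ := by
            rw [mul_right_comm, ← ENNReal.ofReal_mul (by positivity), ← Real.rpow_neg_one,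
              ← Real.rpow_add ht0]
            norm_num
    _ = ENNReal.ofReal M ^ 2 * (Jl * (Jl * G)) := by rw [lintegral_mul_const _ (by fun_prop)]
    _ ≤ ENNReal.ofReal M ^ 2 * (ENNReal.ofReal J * (ENNReal.ofReal J * G)) := by gcongr
    _ = _ := by rw [ENNReal.ofReal_mul hM0]; ring

lemma ofReal_integral_sq {α : Type*} [MeasurableSpace α] {μ : Measure α} {u : α → ℝ}
    (hu : MemLp u 2 μ) : ENNReal.ofReal (∫ x, u x ^ 2 ∂μ) = ∫⁻ x, ‖u x‖ₑ ^ 2 ∂μ := by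
  rw [ofReal_integral_eq_lintegral_ofReal hu.integrable_sq (ae_of_all _ fun x => sq_nonneg _)]
  refine lintegral_congr fun x => ?_
  rw [← sq_abs, ENNReal.ofReal_pow (abs_nonneg _), ← ofReal_norm, Real.norm_eq_abs]

lemma memLp_two_of_lintegral_sq {α : Type*} [MeasurableSpace α] {μ : Measure α} {u : α → ℝ}
    (hu : AEStronglyMeasurable u μ) (h : ∫⁻ x, ‖u x‖ₑ ^ 2 ∂μ < ⊤) : MemLp u 2 μ := by
  refine ⟨hu, ?_⟩
  rw [eLpNorm_lt_top_iff_lintegral_rpow_enorm_lt_top two_ne_zero ENNReal.ofNat_ne_top]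
  simpa using h

lemma lintegral_rpow_neg_half_le {δ J : ℝ} (hδ : 0 ≤ δ) (hδ1 : δ ≤ 1)
    (hJ : 2 * (1 - δ ^ (1 / 2 : ℝ)) ≤ J) :
    ∫⁻ t in Ioo δ 1, ENNReal.ofReal (t ^ (-(1 / 2) : ℝ)) ≤ ENNReal.ofReal J := by
  have h1 : IntegrableOn (fun t : ℝ => t ^ (-(1 / 2) : ℝ)) (Ioc δ 1) :=
    (intervalIntegrable_iff_integrableOn_Ioc_of_le hδ1).1
      (intervalIntegral.intervalIntegrable_rpow' (by norm_num))
  rw [← ofReal_integral_eq_lintegral_ofReal (h1.mono_set Ioo_subset_Ioc_self)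
    ((ae_restrict_iff' measurableSet_Ioo).2 (ae_of_all _ fun t ht =>
      Real.rpow_nonneg (hδ.trans ht.1.le) _))]
  refine ENNReal.ofReal_le_ofReal (le_trans (le_of_eq ?_) hJ)
  rw [← integral_Ioc_eq_integral_Ioo, ← intervalIntegral.integral_of_le hδ1,
    integral_rpow (Or.inl (by norm_num))]
  norm_num
  ring

lemma aestronglyMeasurable_dilAvg {w g : ℝ → ℝ} (hw : Measurable w)
    (hg : AEStronglyMeasurable g unitVol) : AEStronglyMeasurable (dilAvg w g) unitVol := by
  have hm : StronglyMeasurable (Function.uncurry fun s t : ℝ => hg.mk g (t * s) * w t) := by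
    have h1 : Measurable (hg.mk g) := hg.stronglyMeasurable_mk.measurable
    have h2 : Measurable (Function.uncurry fun s t : ℝ => hg.mk g (t * s) * w t) := by
      unfold Function.uncurry
      fun_prop
    exact h2.stronglyMeasurable
  refine ⟨fun s => ∫ t, hg.mk g (t * s) * w t ∂unitVol, hm.integral_prod_right, ?_⟩
  filter_upwards [ae_restrict_mem measurableSet_Ioo] with s hs
  rw [dilAvg_congr hg.ae_eq_mk hs, dilAvg_eq_setIntegral]

lemma lintegral_dilAvg_sq_le_of_aestronglyMeasurable {w g : ℝ → ℝ}
    (hg : AEStronglyMeasurable g unitVol)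
    {M δ J : ℝ} (hδ : 0 ≤ δ) (hM : ∀ t ∈ Ioo δ 1, |w t| ≤ M)
    (hg0 : ∀ x ∈ Ioo 0 δ, g x = 0)
    (hJ : ∫⁻ t in Ioo δ 1, ENNReal.ofReal (t ^ (-(1 / 2) : ℝ)) ≤ ENNReal.ofReal J) :
    ∫⁻ s, ‖dilAvg w g s‖ₑ ^ 2 ∂unitVol ≤
      ENNReal.ofReal (M * J) ^ 2 * ∫⁻ x, ‖g x‖ₑ ^ 2 ∂unitVol := by
  -- A measurable representative may be nonzero somewhere on `(0,δ)`; the indicator restores the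
  -- pointwise vanishing.
  set g' : ℝ → ℝ := (Ici δ).indicator (hg.mk g)
  have hgg' : g =ᵐ[unitVol] g' := by
    filter_upwards [ae_restrict_mem measurableSet_Ioo, hg.ae_eq_mk] with x hx hx'
    by_cases h : δ ≤ x
    · exact hx'.trans (indicator_of_mem (by exact h) _).symm
    · exact (hg0 x ⟨hx.1, not_le.1 h⟩).trans (indicator_of_notMem (by exact h) _).symm
  have h := lintegral_dilAvg_sq_le (w := w) (g := g')
    (hg.stronglyMeasurable_mk.measurable.indicator measurableSet_Ici) hδ hM
    (fun x hx => indicator_of_notMem (not_le.2 hx.2) _) hJ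
  have e1 : ∫⁻ s, ‖dilAvg w g s‖ₑ ^ 2 ∂unitVol = ∫⁻ s, ‖dilAvg w g' s‖ₑ ^ 2 ∂unitVol :=
    setLIntegral_congr_fun measurableSet_Ioo fun s hs => by
      simp only [dilAvg_congr hgg' hs]
  have e2 : ∫⁻ x, ‖g x‖ₑ ^ 2 ∂unitVol = ∫⁻ x, ‖g' x‖ₑ ^ 2 ∂unitVol :=
    lintegral_congr_ae (hgg'.mono fun x hx => by simp only [hx])
  rwa [e1, e2]

lemma memLp_dilAvg {w g : ℝ → ℝ} (hw : Measurable w) {M : ℝ} (hM : ∀ t ∈ Ioo 0 1, |w t| ≤ M)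
    (hg : MemLp g 2 unitVol) : MemLp (dilAvg w g) 2 unitVol := by
  refine memLp_two_of_lintegral_sq (aestronglyMeasurable_dilAvg hw hg.1) ?_
  refine (lintegral_dilAvg_sq_le_of_aestronglyMeasurable hg.1 le_rfl hM (by simp)
    (lintegral_rpow_neg_half_le le_rfl zero_le_one le_rfl)).trans_lt ?_
  rw [← ofReal_integral_sq hg]
  exact ENNReal.mul_lt_top (ENNReal.pow_lt_top ENNReal.ofReal_lt_top) ENNReal.ofReal_lt_top

/-- Averaging dilates is bounded on `L²`; the bound improves if `g` lives near `1`. -/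
lemma integral_dilAvg_sq_le {w g : ℝ → ℝ} (hw : Measurable w) {M₀ : ℝ}
    (hM₀ : ∀ t ∈ Ioo 0 1, |w t| ≤ M₀) (hg : MemLp g 2 unitVol)
    {M δ J : ℝ} (hδ : 0 ≤ δ) (hδ1 : δ < 1) (hM : ∀ t ∈ Ioo δ 1, |w t| ≤ M)
    (hg0 : ∀ x ∈ Ioo 0 δ, g x = 0) (hJ : 2 * (1 - δ ^ (1 / 2 : ℝ)) ≤ J) :
    ∫ s, dilAvg w g s ^ 2 ∂unitVol ≤ (M * J) ^ 2 * ∫ x, g x ^ 2 ∂unitVol := by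
  have hM0 : 0 ≤ M := (abs_nonneg _).trans (hM ((δ + 1) / 2) ⟨by linarith, by linarith⟩)
  have hJ0 : 0 ≤ J := le_trans (by
    have := Real.rpow_le_one hδ hδ1.le (by norm_num : (0 : ℝ) ≤ 1 / 2)
    linarith) hJ
  have h := lintegral_dilAvg_sq_le_of_aestronglyMeasurable hg.1 hδ hM hg0
    (lintegral_rpow_neg_half_le hδ hδ1.le hJ)
  rw [← ofReal_integral_sq hg, ← ofReal_integral_sq (memLp_dilAvg hw hM₀ hg),
    ← ENNReal.ofReal_pow (by positivity), ← ENNReal.ofReal_mul (by positivity)] at h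
  exact (ENNReal.ofReal_le_ofReal_iff
    (mul_nonneg (by positivity) (integral_nonneg fun x => sq_nonneg _))).1 h

lemma integrable_comp_mul_mul {w g : ℝ → ℝ} (hw : Measurable w) {M : ℝ}
    (hM : ∀ t ∈ Ioo 0 1, |w t| ≤ M) (hg : MemLp g 2 unitVol) {s : ℝ} (hs : s ∈ Ioo (0 : ℝ) 1) :
    Integrable (fun t => g (t * s) * w t) unitVol := by
  refine ((memLp_comp_mul hg hs).integrable one_le_two).mul_bdd (c := M)
    hw.aestronglyMeasurable ?_
  filter_upwards [ae_restrict_mem measurableSet_Ioo] with t ht using hM t ht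

lemma dilAvg_add {w g g' : ℝ → ℝ} (hw : Measurable w) {M : ℝ}
    (hM : ∀ t ∈ Ioo 0 1, |w t| ≤ M) (hg : MemLp g 2 unitVol) (hg' : MemLp g' 2 unitVol)
    {s : ℝ} (hs : s ∈ Ioo (0 : ℝ) 1) :
    dilAvg w (fun x => g x + g' x) s = dilAvg w g s + dilAvg w g' s := by
  simp only [dilAvg_eq_setIntegral]
  rw [← integral_add (integrable_comp_mul_mul hw hM hg hs) (integrable_comp_mul_mul hw hM hg' hs)]
  simp only [add_mul]

lemma dilAvg_sub {w g g' : ℝ → ℝ} (hw : Measurable w) {M : ℝ}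
    (hM : ∀ t ∈ Ioo 0 1, |w t| ≤ M) (hg : MemLp g 2 unitVol) (hg' : MemLp g' 2 unitVol)
    {s : ℝ} (hs : s ∈ Ioo (0 : ℝ) 1) :
    dilAvg w (fun x => g x - g' x) s = dilAvg w g s - dilAvg w g' s := by
  simp only [dilAvg_eq_setIntegral]
  rw [← integral_sub (integrable_comp_mul_mul hw hM hg hs) (integrable_comp_mul_mul hw hM hg' hs)]
  simp only [sub_mul]

/-! ### Averages of dilates: weak derivatives -/

lemma locallyIntegrableOn_of_memLp {u : ℝ → ℝ} {a b : ℝ}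
    (hu : MemLp u 2 (volume.restrict (Ioo a b))) : LocallyIntegrableOn u (Ioo a b) :=
  IntegrableOn.locallyIntegrableOn (hu.integrable one_le_two)

lemma setIntegral_mul_eq_integral_of_tsupport_subset {φ : ℝ → ℝ} {S : Set ℝ}
    (h : tsupport φ ⊆ S) (u : ℝ → ℝ) : ∫ x in S, u x * φ x = ∫ x, u x * φ x :=
  setIntegral_eq_integral_of_forall_compl_eq_zero fun x hx => by
    rw [image_eq_zero_of_notMem_tsupport (fun h' => hx (h h')), mul_zero]

/-- The weak derivative of a dilate, tested against `φ`. -/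
lemma HasWeakDeriv.integral_comp_mul {g g' : ℝ → ℝ} (h : HasWeakDeriv 0 1 1 g g') {φ : ℝ → ℝ}
    (hφ : ContDiff ℝ ∞ φ) (hφs : tsupport φ ⊆ Ioo 0 1) {t : ℝ} (ht : t ∈ Ioo (0 : ℝ) 1) :
    ∫ s, g (t * s) * deriv φ s ∂unitVol = -(t * ∫ s, g' (t * s) * φ s ∂unitVol) := by
  have ht0 : t ≠ 0 := ht.1.ne'
  -- The test function transported by `x = t s`; its support lies in `(0,t) ⊆ (0,1)`, so it is
  -- admissible for `g`.
  set ψ : ℝ → ℝ := fun x => φ (x * t⁻¹)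
  have hψ : ContDiff ℝ ∞ ψ := hφ.comp (contDiff_id.mul contDiff_const)
  have hψs : tsupport ψ ⊆ Ioo 0 1 := by
    have h1 : tsupport ψ ⊆ (fun x => x * t⁻¹) ⁻¹' tsupport φ :=
      closure_minimal (fun x hx => subset_tsupport φ hx)
        ((isClosed_tsupport φ).preimage (by fun_prop))
    intro x hx
    obtain ⟨h2, h3⟩ := hφs (h1 hx)
    have h4 : x = x * t⁻¹ * t := by field_simp
    rw [h4]
    exact ⟨mul_pos h2 ht.1, by nlinarith [ht.1, ht.2]⟩
  have hψc : HasCompactSupport ψ :=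
    HasCompactSupport.of_support_subset_isCompact (isCompact_Icc (a := (0 : ℝ)) (b := 1))
      ((subset_tsupport ψ).trans (hψs.trans Ioo_subset_Icc_self))
  have hd : ∀ x, deriv ψ x = deriv φ (x * t⁻¹) * t⁻¹ := fun x => by
    have h1 : HasDerivAt φ (deriv φ (x * t⁻¹)) (x * t⁻¹) :=
      (hφ.differentiable (by simp)).differentiableAt.hasDerivAt
    exact (h1.comp x ((hasDerivAt_id x).mul_const t⁻¹)).deriv.trans (by simp)
  have key := h.2.2 ψ hψ hψc hψs
  simp only [iteratedDeriv_one, pow_one] at key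
  rw [setIntegral_mul_eq_integral_of_tsupport_subset ((tsupport_deriv_subset).trans hψs),
    setIntegral_mul_eq_integral_of_tsupport_subset hψs] at key
  rw [setIntegral_mul_eq_integral_of_tsupport_subset ((tsupport_deriv_subset).trans hφs),
    setIntegral_mul_eq_integral_of_tsupport_subset hφs]
  have e3 : ∀ s, t * s * t⁻¹ = s := fun s => by field_simp
  have e1 : ∫ s, g (t * s) * deriv φ s = ∫ x, g x * deriv ψ x := by
    have e := Measure.integral_comp_mul_left (fun x => g x * deriv ψ x) t
    have e4 : ∀ s, g (t * s) * deriv ψ (t * s) = t⁻¹ * (g (t * s) * deriv φ s) := fun s => by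
      rw [hd, e3]; ring
    simp only [e4, integral_const_mul, abs_of_pos (inv_pos.2 ht.1), smul_eq_mul] at e
    exact mul_left_cancel₀ (inv_ne_zero ht0) e
  have e2 : ∫ s, g' (t * s) * φ s = t⁻¹ * ∫ x, g' x * ψ x := by
    have e := Measure.integral_comp_mul_left (fun x => g' x * ψ x) t
    simpa only [ψ, e3, abs_of_pos (inv_pos.2 ht.1), smul_eq_mul] using e
  rw [e1, e2, key, ← mul_assoc, mul_inv_cancel₀ ht0]
  ring

/-- Fubini. Joint integrability comes from the `L²` bound for the average of `|g|` with weight `1`,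
the factors `w` and `φ` being bounded. -/
lemma integral_dilAvg_mul {w g φ : ℝ → ℝ} (hw : Measurable w) {M : ℝ}
    (hM : ∀ t ∈ Ioo 0 1, |w t| ≤ M) (hg : MemLp g 2 unitVol) (hφ : Continuous φ)
    (hφc : HasCompactSupport φ) :
    ∫ s, dilAvg w g s * φ s ∂unitVol = ∫ t, w t * ∫ s, g (t * s) * φ s ∂unitVol ∂unitVol := by
  obtain ⟨C, hC⟩ := hφ.bounded_above_of_compact_support hφc
  set g' := hg.1.mk g
  have hg'm : Measurable g' := hg.1.stronglyMeasurable_mk.measurable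
  have hgg' : g =ᵐ[unitVol] g' := hg.1.ae_eq_mk
  have hg' : MemLp g' 2 unitVol := hg.ae_eq hgg'
  have hmeas : Measurable fun p : ℝ × ℝ => g' (p.2 * p.1) := by fun_prop
  have hint1 : Integrable (fun p : ℝ × ℝ => g' (p.2 * p.1)) (unitVol.prod unitVol) := by
    rw [integrable_prod_iff hmeas.aestronglyMeasurable]
    constructor
    · filter_upwards [ae_restrict_mem measurableSet_Ioo] with s hs
      exact (memLp_comp_mul hg' hs).integrable one_le_two
    · have h := memLp_dilAvg (w := fun _ => 1) measurable_const (M := 1) (by simp) hg'.norm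
      refine (h.integrable one_le_two).congr (ae_of_all _ fun s => ?_)
      simp [dilAvg_eq_setIntegral]
  have hint : Integrable (fun p : ℝ × ℝ => g' (p.2 * p.1) * w p.2 * φ p.1)
      (unitVol.prod unitVol) := by
    refine (hint1.mul_bdd (c := M)
      ((hw.comp measurable_snd).aestronglyMeasurable) ?_).mul_bdd (c := C) (by fun_prop)
      (ae_of_all _ fun p => hC _)
    have : ∀ᵐ t ∂unitVol, ‖w t‖ ≤ M := by
      filter_upwards [ae_restrict_mem measurableSet_Ioo] with t ht using hM t ht
    exact Measure.quasiMeasurePreserving_snd.ae this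
  calc _ = ∫ s, ∫ t, g' (t * s) * w t * φ s ∂unitVol ∂unitVol := by
        refine setIntegral_congr_fun measurableSet_Ioo fun s hs => ?_
        simp only [dilAvg_congr hgg' hs, dilAvg_eq_setIntegral, integral_mul_const]
    _ = ∫ t, ∫ s, g' (t * s) * w t * φ s ∂unitVol ∂unitVol := integral_integral_swap hint
    _ = _ := by
        refine setIntegral_congr_fun measurableSet_Ioo fun t ht => ?_
        rw [← integral_const_mul]
        refine integral_congr_ae ?_
        filter_upwards [ae_comp_mul hgg' ht] with s hs
        rw [mul_comm t s, hs]
        ring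

/-- Averaging dilates commutes with weak differentiation, up to an extra factor in the weight. -/
lemma hasWeakDeriv_dilAvg {w g g' : ℝ → ℝ} (hw : Measurable w) {M : ℝ}
    (hM : ∀ t ∈ Ioo 0 1, |w t| ≤ M) (hg : MemLp g 2 unitVol) (hg' : MemLp g' 2 unitVol)
    (h : HasWeakDeriv 0 1 1 g g') :
    HasWeakDeriv 0 1 1 (dilAvg w g) (dilAvg (fun t => t * w t) g') := by
  have hw' : Measurable fun t => t * w t := by fun_prop
  have hM' : ∀ t ∈ Ioo (0 : ℝ) 1, |t * w t| ≤ M := fun t ht => by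
    rw [abs_mul, abs_of_pos ht.1]
    exact (mul_le_of_le_one_left (abs_nonneg _) ht.2.le).trans (hM t ht)
  refine ⟨locallyIntegrableOn_of_memLp (memLp_dilAvg hw hM hg),
    locallyIntegrableOn_of_memLp (memLp_dilAvg hw' hM' hg'), fun φ hφ hφc hφs => ?_⟩
  simp only [iteratedDeriv_one, pow_one]
  rw [integral_dilAvg_mul hw hM hg (hφ.continuous_deriv (by simp)) hφc.deriv,
    integral_dilAvg_mul hw' hM' hg' hφ.continuous hφc, ← integral_const_mul]
  refine setIntegral_congr_fun measurableSet_Ioo fun t ht => ?_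
  simp only [h.integral_comp_mul hφ hφs ht]
  ring

/-! ### Injectivity on cosine sums -/

lemma hasDerivAt_dilAvg {w g : ℝ → ℝ} (hw : Measurable w) {M : ℝ}
    (hM : ∀ t ∈ Ioo 0 1, |w t| ≤ M) (hg : ContDiff ℝ 1 g) (s : ℝ) :
    HasDerivAt (dilAvg w g) (dilAvg (fun t => t * w t) (deriv g) s) s := by
  have hg' : Continuous (deriv g) := hg.continuous_deriv le_rfl
  have hgc : Continuous g := hg.continuous
  obtain ⟨C, hC⟩ := (isCompact_Icc (a := -(|s| + 1)) (b := |s| + 1)).exists_bound_of_continuousOn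
    hg'.continuousOn
  have hae : ∀ᵐ t ∂unitVol, t ∈ Ioo (0 : ℝ) 1 := ae_restrict_mem measurableSet_Ioo
  have hball : ∀ x ∈ Metric.ball s 1, |x| ≤ |s| + 1 := fun x hx => by
    have h1 : |x - s| < 1 := by simpa [Real.dist_eq] using hx
    have h2 := abs_sub_abs_le_abs_sub x s
    linarith
  have hfun : dilAvg w g = fun s => ∫ t, g (t * s) * w t ∂unitVol :=
    funext fun s => dilAvg_eq_setIntegral w g s
  have hint : Integrable (fun t => g (t * s) * w t) unitVol := by
    have h1 : Integrable (fun t => g (t * s)) unitVol :=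
      ((show Continuous fun t => g (t * s) by fun_prop).integrableOn_Icc
        (a := 0) (b := 1)).mono_set Ioo_subset_Icc_self
    exact h1.mul_bdd (c := M) hw.aestronglyMeasurable (hae.mono fun t ht => hM t ht)
  have h := (hasDerivAt_integral_of_dominated_loc_of_deriv_le (μ := unitVol) (x₀ := s)
    (s := Metric.ball s 1) (F := fun s t => g (t * s) * w t)
    (F' := fun s t => deriv g (t * s) * (t * w t)) (bound := fun _ => C * M)
    (Metric.ball_mem_nhds s one_pos)
    (Filter.Eventually.of_forall fun x => by
      exact ((show Continuous fun t => g (t * x) by fun_prop).measurable.mul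
        hw).aestronglyMeasurable) hint
    ((show Continuous fun t => deriv g (t * s) by fun_prop).measurable.mul
        (measurable_id.mul hw)).aestronglyMeasurable ?_ (integrable_const _) ?_).2
  · rw [hfun, dilAvg_eq_setIntegral]
    exact h
  · filter_upwards [hae] with t ht x hx
    rw [norm_mul, norm_mul, Real.norm_of_nonneg ht.1.le]
    have h1 : ‖deriv g (t * x)‖ ≤ C := hC _ (abs_le.1 (by
      rw [abs_mul, abs_of_pos ht.1]
      exact (mul_le_of_le_one_left (abs_nonneg _) ht.2.le).trans (hball x hx)))
    have h2 : t * ‖w t‖ ≤ M := (mul_le_of_le_one_left (norm_nonneg _) ht.2.le).trans (hM t ht)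
    have hC0 : 0 ≤ C := (norm_nonneg _).trans h1
    have ht0 := ht.1.le
    gcongr
  · filter_upwards [hae] with t ht x hx
    have h1 : HasDerivAt g (deriv g (t * x)) (t * x) :=
      (hg.differentiable one_ne_zero).differentiableAt.hasDerivAt
    have h2 := (h1.comp x ((hasDerivAt_id x).const_mul t)).mul_const (w t)
    refine h2.congr_deriv ?_
    simp only [mul_one]
    ring

/-- If `dilAvg w g` vanishes on `(0,1)`, then all derivatives of `g` vanish at `0`. -/
lemma iteratedDeriv_eq_zero_of_dilAvg {w g : ℝ → ℝ} (hw : Measurable w) {M : ℝ}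
    (hM : ∀ t ∈ Ioo 0 1, |w t| ≤ M) (hpos : ∀ t ∈ Ioo 0 1, 0 < w t) (hg : ContDiff ℝ ∞ g)
    (h : ∀ᵐ s ∂unitVol, dilAvg w g s = 0) (n : ℕ) : iteratedDeriv n g 0 = 0 := by
  have hwn : ∀ n : ℕ, Measurable fun t => t ^ n * w t := fun n => by fun_prop
  have hMn : ∀ n : ℕ, ∀ t ∈ Ioo (0 : ℝ) 1, |t ^ n * w t| ≤ M := fun n t ht => by
    rw [abs_mul, abs_of_pos (pow_pos ht.1 n)]
    exact (mul_le_of_le_one_left (abs_nonneg _) (pow_le_one₀ ht.1.le ht.2.le)).trans (hM t ht)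
  have hgn : ∀ n : ℕ, ContDiff ℝ 1 (iteratedDeriv n g) := fun n => by
    rw [iteratedDeriv_eq_iterate]
    exact ContDiff.iterate_deriv' 1 n (hg.of_le (by exact_mod_cast le_top))
  have hder := fun n s => hasDerivAt_dilAvg (hwn n) (hMn n) (hgn n) s
  have hcont : ∀ n, Continuous (dilAvg (fun t => t ^ n * w t) (iteratedDeriv n g)) := fun n =>
    continuous_iff_continuousAt.2 fun s => (hder n s).continuousAt
  -- Differentiating an identity that holds on an open interval: the `n`-th derivative of the
  -- average is the average of the `n`-th derivative of `g` with weight `t ^ n * w t`.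
  have hz : ∀ n, EqOn (dilAvg (fun t => t ^ n * w t) (iteratedDeriv n g)) 0 (Ioo 0 1) := by
    intro n
    induction n with
    | zero =>
      refine Measure.eqOn_open_of_ae_eq (μ := volume) ?_ isOpen_Ioo (hcont 0).continuousOn continuousOn_const
      filter_upwards [h] with s hs
      simpa using hs
    | succ n ih =>
      intro s hs
      have h1 : dilAvg (fun t => t ^ n * w t) (iteratedDeriv n g) =ᶠ[nhds s] fun _ => 0 :=
        Filter.eventuallyEq_of_mem (Ioo_mem_nhds hs.1 hs.2) ih
      have h2 := (hder n s).unique ((hasDerivAt_const s (0 : ℝ)).congr_of_eventuallyEq h1)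
      rw [Pi.zero_apply, ← h2, ← iteratedDeriv_succ]
      congr 1
      ext t
      ring
  -- By continuity the identity persists at `s = 0`, where it reads: the `n`-th derivative of `g` at
  -- `0`, times a positive integral, is zero.
  have h0 : dilAvg (fun t => t ^ n * w t) (iteratedDeriv n g) 0 = 0 := by
    have := (hz n).closure (hcont n) continuous_const
    rw [closure_Ioo zero_ne_one] at this
    exact this ⟨le_rfl, zero_le_one⟩
  simp only [dilAvg, mul_zero, intervalIntegral.integral_const_mul] at h0
  refine (mul_eq_zero.1 h0).resolve_right (ne_of_gt ?_)
  refine intervalIntegral.intervalIntegral_pos_of_pos_on ?_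
    (fun t ht => mul_pos (pow_pos ht.1 n) (hpos t ht)) zero_lt_one
  rw [intervalIntegrable_iff_integrableOn_Ioo_of_le zero_le_one]
  exact Integrable.of_bound (hwn n).aestronglyMeasurable M
    ((ae_restrict_mem measurableSet_Ioo).mono fun t ht => hMn n t ht)

/-- The derivative of `cosBasis k`. -/
noncomputable def cosBasisDeriv (k : ℕ) (t : ℝ) : ℝ :=
  -(Real.sqrt 2 * (Real.pi * k) * Real.sin (Real.pi * k * t))

/-- The derivative of `cosSum a`. -/
noncomputable def cosSumDeriv {K : ℕ} (a : Fin K → ℝ) (t : ℝ) : ℝ :=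
  ∑ k : Fin K, a k * cosBasisDeriv k t

lemma hasDerivAt_cosBasis (k : ℕ) (t : ℝ) : HasDerivAt (cosBasis k) (cosBasisDeriv k t) t := by
  rcases eq_or_ne k 0 with rfl | hk
  · have : cosBasis 0 = fun _ => 1 := by ext; simp [cosBasis]
    rw [this]
    exact (hasDerivAt_const t (1 : ℝ)).congr_deriv (by simp [cosBasisDeriv])
  · have : cosBasis k = fun t => Real.sqrt 2 * Real.cos (Real.pi * k * t) := by
      ext; simp [cosBasis, hk]
    rw [this]
    have h := (((hasDerivAt_id t).const_mul (Real.pi * k)).cos).const_mul (Real.sqrt 2)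
    refine h.congr_deriv ?_
    simp only [cosBasisDeriv, id_eq]
    ring

lemma hasDerivAt_cosBasisDeriv (k : ℕ) (t : ℝ) :
    HasDerivAt (cosBasisDeriv k) (-(Real.pi * k) ^ 2 * cosBasis k t) t := by
  have h := ((((hasDerivAt_id t).const_mul (Real.pi * k)).sin).const_mul
    (Real.sqrt 2 * (Real.pi * k))).neg
  refine HasDerivAt.congr_deriv (f := cosBasisDeriv k) h ?_
  rcases eq_or_ne k 0 with rfl | hk
  · simp
  · simp only [cosBasis, hk, if_false, id_eq]
    ring

lemma hasDerivAt_cosSum {K : ℕ} (a : Fin K → ℝ) (t : ℝ) :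
    HasDerivAt (cosSum a) (cosSumDeriv a t) t :=
  HasDerivAt.fun_sum fun k _ => (hasDerivAt_cosBasis k t).const_mul (a k)

lemma hasDerivAt_cosSumDeriv {K : ℕ} (a : Fin K → ℝ) (t : ℝ) :
    HasDerivAt (cosSumDeriv a) (cosSum (fun k => -(Real.pi * k) ^ 2 * a k) t) t := by
  have h := HasDerivAt.fun_sum fun (k : Fin K) (_ : k ∈ Finset.univ) =>
    (hasDerivAt_cosBasisDeriv k t).const_mul (a k)
  exact h.congr_deriv (Finset.sum_congr rfl fun k _ => by ring)

lemma deriv_cosSum {K : ℕ} (a : Fin K → ℝ) : deriv (cosSum a) = cosSumDeriv a :=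
  funext fun t => (hasDerivAt_cosSum a t).deriv

lemma iteratedDeriv_two_mul_cosSum {K : ℕ} (a : Fin K → ℝ) (m : ℕ) :
    iteratedDeriv (2 * m) (cosSum a) = cosSum (fun k => (-(Real.pi * k) ^ 2) ^ m * a k) := by
  induction m with
  | zero => simp
  | succ m ih =>
    rw [mul_add, mul_one, iteratedDeriv_succ, iteratedDeriv_succ, ih, deriv_cosSum]
    ext t
    rw [(hasDerivAt_cosSumDeriv _ t).deriv]
    congr 1
    ext k
    ring

lemma contDiff_cosBasis (k : ℕ) : ContDiff ℝ ∞ (cosBasis k) := by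
  rcases eq_or_ne k 0 with rfl | hk
  · have : cosBasis 0 = fun _ => 1 := by ext; simp [cosBasis]
    rw [this]
    exact contDiff_const
  · have : cosBasis k = fun t => Real.sqrt 2 * Real.cos (Real.pi * k * t) := by
      ext; simp [cosBasis, hk]
    rw [this]
    fun_prop

lemma contDiff_cosSum {K : ℕ} (a : Fin K → ℝ) : ContDiff ℝ ∞ (cosSum a) :=
  ContDiff.sum fun k _ => contDiff_const.mul (contDiff_cosBasis k)

lemma cosBasis_zero_ne_zero (k : ℕ) : cosBasis k 0 ≠ 0 := by
  unfold cosBasis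
  split_ifs <;> simp

/-- Averaging dilates is injective on cosine sums. -/
lemma eq_zero_of_dilAvg_cosSum {w : ℝ → ℝ} (hw : Measurable w) {M : ℝ}
    (hM : ∀ t ∈ Ioo 0 1, |w t| ≤ M) (hpos : ∀ t ∈ Ioo 0 1, 0 < w t) {K : ℕ} {a : Fin K → ℝ}
    (h : ∀ᵐ s ∂unitVol, dilAvg w (cosSum a) s = 0) : a = 0 := by
  have h1 := fun m : ℕ =>
    iteratedDeriv_eq_zero_of_dilAvg hw hM hpos (contDiff_cosSum a) h (2 * m)
  have hinj : Function.Injective fun k : Fin K => -(Real.pi * k) ^ 2 := fun i j hij => by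
    have hij' : (Real.pi * i) ^ 2 = (Real.pi * j) ^ 2 := neg_injective hij
    rw [sq_eq_sq₀ (by positivity) (by positivity)] at hij'
    exact Fin.ext (by exact_mod_cast mul_left_cancel₀ Real.pi_ne_zero hij')
  -- The derivatives of even order `2m` at `0` are power sums with the distinct nodes `-(π k)²`, so
  -- this is a Vandermonde system.
  have h2 : (fun k : Fin K => a k * cosBasis k 0) = 0 := by
    refine Matrix.eq_zero_of_forall_pow_sum_mul_pow_eq_zero hinj fun i => ?_
    have := h1 i
    rw [iteratedDeriv_two_mul_cosSum] at this
    exact (Finset.sum_congr rfl fun k _ => by ring).trans this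
  ext k
  exact (mul_eq_zero.1 (congrFun h2 k)).resolve_right (cosBasis_zero_ne_zero k)

/-! ### Existence and uniqueness of minimizers -/

/-- Linear least squares with linearly independent columns has a unique solution. -/
lemma existsUnique_leastSquares {E : Type*} [NormedAddCommGroup E] [InnerProductSpace ℝ E] {K : ℕ}
    {p : Fin K → E} (hp : LinearIndependent ℝ p) (x : E) :
    ∃! a : Fin K → ℝ, ∀ b : Fin K → ℝ,
      ‖∑ k, a k • p k - x‖ ^ 2 ≤ ‖∑ k, b k • p k - x‖ ^ 2 := by
  set U := Submodule.span ℝ (Set.range p)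
  have : FiniteDimensional ℝ U := FiniteDimensional.span_of_finite ℝ (finite_range p)
  set y := U.starProjection x
  obtain ⟨a, ha⟩ := (Submodule.mem_span_range_iff_exists_fun ℝ).1 (U.starProjection_apply_mem x)
  have hmem : ∀ b : Fin K → ℝ, ∑ k, b k • p k ∈ U := fun b =>
    (Submodule.mem_span_range_iff_exists_fun ℝ).2 ⟨b, rfl⟩
  -- Pythagoras: minimizing the distance to `x` means hitting its orthogonal projection `y`, and
  -- independence makes the coefficients of `y` unique.
  have hpyth : ∀ b : Fin K → ℝ, ‖∑ k, b k • p k - x‖ ^ 2 =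
      ‖∑ k, b k • p k - y‖ ^ 2 + ‖y - x‖ ^ 2 := fun b => by
    have h : inner ℝ (∑ k, b k • p k - y) (y - x) = 0 := by
      rw [real_inner_comm, ← neg_sub x y, inner_neg_left,
        U.starProjection_inner_eq_zero x _ (U.sub_mem (hmem b) (U.starProjection_apply_mem x)),
        neg_zero]
    have := norm_add_sq_eq_norm_sq_add_norm_sq_real h
    rw [sub_add_sub_cancel] at this
    simpa only [sq] using this
  refine ⟨a, fun b => ?_, fun a' ha' => ?_⟩
  · rw [hpyth a, hpyth b, ha, sub_self, norm_zero]
    nlinarith [sq_nonneg ‖∑ k, b k • p k - y‖]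
  · have h1 := ha' a
    rw [hpyth a, hpyth a', ha, sub_self, norm_zero] at h1
    have h2 : ‖∑ k, a' k • p k - y‖ ^ 2 = 0 := le_antisymm (by linarith) (sq_nonneg _)
    have h3 : ∑ k, a' k • p k = ∑ k, a k • p k := by
      rw [ha]
      exact sub_eq_zero.1 (norm_eq_zero.1 (pow_eq_zero_iff two_ne_zero |>.1 h2))
    have h4 : ∑ k, (a' k - a k) • p k = 0 := by
      simp only [sub_smul, Finset.sum_sub_distrib, h3, sub_self]
    ext k
    exact sub_eq_zero.1 (Fintype.linearIndependent_iff.1 hp _ h4 k)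

lemma norm_sum_toLp_sub_sq {α : Type*} [MeasurableSpace α] {μ : Measure α} {K : ℕ}
    {φ : Fin K → α → ℝ} (hφ : ∀ k, MemLp (φ k) 2 μ) {Y : α → ℝ} (hY : MemLp Y 2 μ)
    (b : Fin K → ℝ) :
    ‖∑ k, b k • (hφ k).toLp - hY.toLp‖ ^ 2 = ∫ s, (∑ k, b k * φ k s - Y s) ^ 2 ∂μ := by
  rw [← real_inner_self_eq_norm_sq, L2.inner_def]
  have h1 : ∀ᵐ s ∂μ, ∀ k, ((hφ k).toLp : Lp ℝ 2 μ) s = φ k s := ae_all_iff.2 fun k => (hφ k).coeFn_toLp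
  have h2 : ∀ᵐ s ∂μ, ∀ k, (b k • (hφ k).toLp : Lp ℝ 2 μ) s = b k • ((hφ k).toLp : Lp ℝ 2 μ) s :=
    ae_all_iff.2 fun k => Lp.coeFn_smul _ _
  refine integral_congr_ae ?_
  filter_upwards [Lp.coeFn_sub (∑ k, b k • (hφ k).toLp) hY.toLp, h1, h2, hY.coeFn_toLp,
    Lp.coeFn_finsetSum Finset.univ (fun k => b k • (hφ k).toLp)] with s a1 a2 a3 a4 a5
  rw [a1, Pi.sub_apply, a5, a4, real_inner_self_eq_norm_sq, Real.norm_eq_abs, sq_abs]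
  simp [a3, a2]

lemma normConst_pos {d : ℕ} (hd : 3 ≤ d) : 0 < normConst d := by
  have h : (3 : ℝ) ≤ d := by exact_mod_cast hd
  have h1 : 0 < Real.Gamma ((d : ℝ) / 2) := Real.Gamma_pos_of_pos (by linarith)
  have h2 : 0 < Real.Gamma (((d : ℝ) - 1) / 2) := Real.Gamma_pos_of_pos (by linarith)
  unfold normConst
  positivity

lemma measurable_density (d : ℕ) : Measurable (density d) := by
  unfold density
  fun_prop

lemma density_pos {d : ℕ} (hd : 3 ≤ d) {t : ℝ} (ht : t ∈ Ioo (0 : ℝ) 1) : 0 < density d t :=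
  mul_pos (normConst_pos hd) (Real.rpow_pos_of_pos (by nlinarith [ht.1, ht.2]) _)

lemma abs_density_le {d : ℕ} (hd : 3 ≤ d) {δ t : ℝ} (hδ : 0 ≤ δ) (ht : t ∈ Ioo δ 1) :
    |density d t| ≤ normConst d * (2 * (1 - δ)) ^ (((d : ℝ) - 3) / 2) := by
  have h : (3 : ℝ) ≤ d := by exact_mod_cast hd
  have ht' : t ∈ Ioo (0 : ℝ) 1 := ⟨hδ.trans_lt ht.1, ht.2⟩
  rw [abs_of_pos (density_pos hd ht'), density]
  have h1 := normConst_pos hd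
  have h2 : 1 - t ^ 2 ≤ 2 * (1 - δ) := by nlinarith [ht.1, ht.2]
  have h3 : 0 ≤ 1 - t ^ 2 := by nlinarith [ht'.1, ht.2]
  gcongr

lemma abs_mul_density_le {d : ℕ} (hd : 3 ≤ d) {δ t : ℝ} (hδ : 0 ≤ δ) (ht : t ∈ Ioo δ 1) :
    |t * density d t| ≤ normConst d * (2 * (1 - δ)) ^ (((d : ℝ) - 3) / 2) := by
  rw [abs_mul, abs_of_pos (hδ.trans_lt ht.1)]
  exact (mul_le_of_le_one_left (abs_nonneg _) ht.2.le).trans (abs_density_le hd hδ ht)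

lemma _root_.Continuous.memLp_Ioo {g : ℝ → ℝ} (hg : Continuous g) (a b : ℝ) :
    MemLp g 2 (volume.restrict (Ioo a b)) := by
  obtain ⟨C, hC⟩ := (isCompact_Icc (a := a) (b := b)).exists_bound_of_continuousOn hg.continuousOn
  exact MemLp.of_bound hg.aestronglyMeasurable C
    ((ae_restrict_mem measurableSet_Ioo).mono fun x hx => hC x (Ioo_subset_Icc_self hx))

lemma continuous_cosBasis (k : ℕ) : Continuous (cosBasis k) := (contDiff_cosBasis k).continuous

lemma continuous_cosBasisDeriv (k : ℕ) : Continuous (cosBasisDeriv k) := by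
  unfold cosBasisDeriv
  fun_prop

lemma continuous_cosSum {K : ℕ} (a : Fin K → ℝ) : Continuous (cosSum a) :=
  (contDiff_cosSum a).continuous

lemma continuous_cosSumDeriv {K : ℕ} (a : Fin K → ℝ) : Continuous (cosSumDeriv a) :=
  continuous_finsetSum _ fun k _ => continuous_const.mul (continuous_cosBasisDeriv k)

lemma dilAvg_sum {w : ℝ → ℝ} (hw : Measurable w) {M : ℝ} (hM : ∀ t ∈ Ioo 0 1, |w t| ≤ M)
    {K : ℕ} {φ : Fin K → ℝ → ℝ} (hφ : ∀ k, MemLp (φ k) 2 unitVol) (b : Fin K → ℝ)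
    {s : ℝ} (hs : s ∈ Ioo (0 : ℝ) 1) :
    dilAvg w (fun t => ∑ k, b k * φ k t) s = ∑ k, b k * dilAvg w (φ k) s := by
  simp only [dilAvg_eq_setIntegral, Finset.sum_mul]
  rw [integral_finsetSum _ fun k _ => ?_]
  · simp only [mul_assoc, integral_const_mul]
  · simp only [mul_assoc]
    exact (integrable_comp_mul_mul hw hM (hφ k) hs).const_mul _

/-- The fundamental lemma of the calculus of variations. It makes the arbitrary choice in
`weakDeriv` harmless, so that `h1Norm` can be computed with any explicit weak derivative. -/
lemma HasWeakDeriv.ae_eq {a b : ℝ} {k : ℕ} {u v v' : ℝ → ℝ} (h : HasWeakDeriv a b k u v)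
    (h' : HasWeakDeriv a b k u v') : v =ᵐ[volume.restrict (Ioo a b)] v' := by
  have hmul : ∀ {v : ℝ → ℝ}, LocallyIntegrableOn v (Ioo a b) → ∀ {φ : ℝ → ℝ}, ContDiff ℝ ∞ φ →
      HasCompactSupport φ → tsupport φ ⊆ Ioo a b →
      Integrable (fun x => φ x • v x) := fun {v} hv {φ} hφ hφc hφs => by
    have h1 : IntegrableOn v (tsupport φ) := (hv.mono_set hφs).integrableOn_isCompact hφc
    have h2 : IntegrableOn (fun x => φ x • v x) (tsupport φ) :=
      h1.continuousOn_smul hφ.continuous.continuousOn hφc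
    rw [← integrableOn_iff_integrable_of_support_subset (s := tsupport φ)]
    · exact h2
    · exact (Function.support_smul_subset_left φ v).trans (subset_tsupport φ)
  have key := isOpen_Ioo.ae_eq_zero_of_integral_contDiff_smul_eq_zero (μ := volume)
    (h.2.1.sub h'.2.1) fun φ hφ hφc hφs => by
      have e := (h.2.2 φ hφ hφc hφs).symm.trans (h'.2.2 φ hφ hφc hφs)
      have e' := mul_left_cancel₀ (pow_ne_zero k (by norm_num : (-1 : ℝ) ≠ 0)) e
      rw [setIntegral_mul_eq_integral_of_tsupport_subset hφs,
        setIntegral_mul_eq_integral_of_tsupport_subset hφs] at e'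
      simp only [Pi.sub_apply, smul_sub]
      rw [integral_sub (hmul h.2.1 hφ hφc hφs) (hmul h'.2.1 hφ hφc hφs)]
      simp only [smul_eq_mul, mul_comm (φ _)]
      rw [e', sub_self]
  filter_upwards [(ae_restrict_iff' measurableSet_Ioo).2 key] with x hx
  exact sub_eq_zero.1 hx

lemma weakDeriv_ae_eq {a b : ℝ} {u v : ℝ → ℝ} (h : HasWeakDeriv a b 1 u v) :
    weakDeriv a b u =ᵐ[volume.restrict (Ioo a b)] v := by
  have hex : ∃ v, HasWeakDeriv a b 1 u v := ⟨v, h⟩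
  rw [weakDeriv, dif_pos hex]
  exact hex.choose_spec.ae_eq h

lemma HasWeakDeriv.congr_left {a b : ℝ} {k : ℕ} {u u' v : ℝ → ℝ} (h : HasWeakDeriv a b k u v)
    (hu' : MemLp u' 2 (volume.restrict (Ioo a b)))
    (huu' : u =ᵐ[volume.restrict (Ioo a b)] u') : HasWeakDeriv a b k u' v := by
  refine ⟨locallyIntegrableOn_of_memLp hu', h.2.1, fun φ hφ hφc hφs => ?_⟩
  rw [← h.2.2 φ hφ hφc hφs]
  exact integral_congr_ae (huu'.mono fun x hx => by simp only [hx])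

lemma integrable_mul_of_compactSupport {a b : ℝ} {u φ : ℝ → ℝ}
    (hu : MemLp u 2 (volume.restrict (Ioo a b))) (hφ : Continuous φ)
    (hφc : HasCompactSupport φ) : Integrable (fun x => u x * φ x) (volume.restrict (Ioo a b)) := by
  obtain ⟨C, hC⟩ := hφ.bounded_above_of_compact_support hφc
  exact (hu.integrable one_le_two).mul_bdd (c := C) hφ.aestronglyMeasurable (ae_of_all _ hC)

lemma HasWeakDeriv.sub {a b : ℝ} {u v u' v' : ℝ → ℝ} (h : HasWeakDeriv a b 1 u v)
    (h' : HasWeakDeriv a b 1 u' v') (hu : MemLp u 2 (volume.restrict (Ioo a b)))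
    (hv : MemLp v 2 (volume.restrict (Ioo a b))) (hu' : MemLp u' 2 (volume.restrict (Ioo a b)))
    (hv' : MemLp v' 2 (volume.restrict (Ioo a b))) :
    HasWeakDeriv a b 1 (fun x => u x - u' x) (fun x => v x - v' x) := by
  refine ⟨h.1.sub h'.1, h.2.1.sub h'.2.1, fun φ hφ hφc hφs => ?_⟩
  have e := h.2.2 φ hφ hφc hφs
  have e' := h'.2.2 φ hφ hφc hφs
  simp only [iteratedDeriv_one] at e e' ⊢
  have hd := hφ.continuous_deriv (by simp)
  simp only [sub_mul]
  rw [integral_sub (integrable_mul_of_compactSupport hu hd hφc.deriv)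
    (integrable_mul_of_compactSupport hu' hd hφc.deriv),
    integral_sub (integrable_mul_of_compactSupport hv hφ.continuous hφc)
    (integrable_mul_of_compactSupport hv' hφ.continuous hφc), e, e']
  ring

lemma hasWeakDeriv_of_hasDerivAt {a b : ℝ} (hab : a ≤ b) {g g' : ℝ → ℝ}
    (h : ∀ x, HasDerivAt g (g' x) x) (hg' : Continuous g') : HasWeakDeriv a b 1 g g' := by
  have hg : Continuous g := continuous_iff_continuousAt.2 fun x => (h x).continuousAt
  refine ⟨hg.locallyIntegrable.locallyIntegrableOn _, hg'.locallyIntegrable.locallyIntegrableOn _,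
    fun φ hφ hφc hφs => ?_⟩
  have h0 : ∀ x, x ∉ Ioo a b → φ x = 0 := fun x hx =>
    image_eq_zero_of_notMem_tsupport fun h' => hx (hφs h')
  have hd := hφ.continuous_deriv (by simp)
  simp only [iteratedDeriv_one, pow_one, ← integral_Ioc_eq_integral_Ioo]
  rw [← intervalIntegral.integral_of_le hab, ← intervalIntegral.integral_of_le hab,
    intervalIntegral.integral_mul_deriv_eq_deriv_mul (fun x _ => h x)
      (fun x _ => (hφ.differentiable (by simp)).differentiableAt.hasDerivAt)
      (hg'.intervalIntegrable _ _) (hd.intervalIntegrable _ _),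
    h0 a (by simp), h0 b (by simp)]
  ring

lemma exists_abs_density_le {d : ℕ} (hd : 3 ≤ d) :
    ∃ M, (∀ t ∈ Ioo (0 : ℝ) 1, |density d t| ≤ M) ∧ ∀ t ∈ Ioo (0 : ℝ) 1, |t * density d t| ≤ M :=
  ⟨_, fun _ ht => abs_density_le hd le_rfl ht, fun _ ht => abs_mul_density_le hd le_rfl ht⟩

/-- A vanishing combination is the average of a cosine sum that is zero almost everywhere, so
injectivity applies. -/
lemma linearIndependent_toLp_dilAvg {d : ℕ} (hd : 3 ≤ d) {K : ℕ}
    (hp : ∀ k : Fin K, MemLp (dilAvg (density d) (cosBasis k)) 2 unitVol) :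
    LinearIndependent ℝ fun k => (hp k).toLp := by
  obtain ⟨M, hM, -⟩ := exists_abs_density_le hd
  rw [Fintype.linearIndependent_iff]
  intro b hb
  have h := norm_sum_toLp_sub_sq hp (MemLp.zero (μ := unitVol) (p := 2) (ε := ℝ)) b
  rw [hb, MemLp.toLp_zero, sub_zero, norm_zero] at h
  simp only [Pi.zero_apply, sub_zero] at h
  have hint : Integrable (fun s => (∑ k, b k * dilAvg (density d) (cosBasis k) s) ^ 2) unitVol :=
    (memLp_finsetSum _ fun k _ => (hp k).const_mul (b k)).integrable_sq
  have h0 := (integral_eq_zero_iff_of_nonneg (fun s => sq_nonneg _) hint).1 (by rw [← h]; simp)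
  have hb0 : b = 0 := by
    refine eq_zero_of_dilAvg_cosSum (measurable_density d) hM (fun t => density_pos hd) ?_
    filter_upwards [h0, ae_restrict_mem measurableSet_Ioo] with s hs hs'
    unfold cosSum
    rw [dilAvg_sum (measurable_density d) hM
      (fun k => (continuous_cosBasis k).memLp_Ioo 0 1) b hs']
    exact pow_eq_zero_iff two_ne_zero |>.1 hs
  exact fun i => congrFun hb0 i

lemma l2Norm_sq (u : ℝ → ℝ) : l2Norm u ^ 2 = ∫ x, u x ^ 2 ∂unitVol :=
  Real.sq_sqrt (integral_nonneg fun _ => sq_nonneg _)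

lemma h1Norm_sq {u v : ℝ → ℝ} (h : HasWeakDeriv 0 1 1 u v) :
    h1Norm u ^ 2 = (∫ x, u x ^ 2 ∂unitVol) + ∫ x, v x ^ 2 ∂unitVol := by
  rw [h1Norm, Real.sq_sqrt (add_nonneg (integral_nonneg fun _ => sq_nonneg _)
    (integral_nonneg fun _ => sq_nonneg _))]
  congr 1
  exact integral_congr_ae ((weakDeriv_ae_eq h).mono fun x hx => by simp only [hx])

theorem existsUnique_isMinimizer_l2Norm {d : ℕ} (hd : 3 ≤ d) {F : ℝ → ℝ}
    (hF : MemLp F 2 unitVol) (K : ℕ) : ∃! a : Fin K → ℝ, IsMinimizer l2Norm d F a := by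
  obtain ⟨M, hM, -⟩ := exists_abs_density_le hd
  have hc := fun k : Fin K => (continuous_cosBasis k).memLp_Ioo 0 1
  have hp := fun k => memLp_dilAvg (measurable_density d) hM (hc k)
  have h := existsUnique_leastSquares (linearIndependent_toLp_dilAvg hd hp) hF.toLp
  simp only [norm_sum_toLp_sub_sq hp hF] at h
  convert h using 2 with a
  have : ∀ b : Fin K → ℝ, l2Norm (fun s => slicing d (cosSum b) s - F s) ^ 2 =
      ∫ s, (∑ k, b k * dilAvg (density d) (cosBasis k) s - F s) ^ 2 ∂unitVol := fun b => by
    rw [l2Norm_sq]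
    refine setIntegral_congr_fun measurableSet_Ioo fun s hs => ?_
    change (dilAvg (density d) (fun t => ∑ k, b k * cosBasis k t) s - F s) ^ 2 = _
    rw [dilAvg_sum (measurable_density d) hM hc b hs]
  simp only [IsMinimizer, this]

lemma hasWeakDeriv_slicing_cosSum {d : ℕ} (hd : 3 ≤ d) {K : ℕ} (b : Fin K → ℝ) :
    HasWeakDeriv 0 1 1 (slicing d (cosSum b))
      (dilAvg (fun t => t * density d t) (cosSumDeriv b)) := by
  obtain ⟨M, hM, -⟩ := exists_abs_density_le hd
  exact hasWeakDeriv_dilAvg (measurable_density d) hM ((continuous_cosSum b).memLp_Ioo 0 1)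
    ((continuous_cosSumDeriv b).memLp_Ioo 0 1)
    (hasWeakDeriv_of_hasDerivAt zero_le_one (hasDerivAt_cosSum b) (continuous_cosSumDeriv b))

lemma memLp_slicing {d : ℕ} (hd : 3 ≤ d) {g : ℝ → ℝ} (hg : MemLp g 2 unitVol) :
    MemLp (slicing d g) 2 unitVol := by
  obtain ⟨M, hM, -⟩ := exists_abs_density_le hd
  exact memLp_dilAvg (measurable_density d) hM hg

lemma memLp_dilAvg_mul_density {d : ℕ} (hd : 3 ≤ d) {g : ℝ → ℝ} (hg : MemLp g 2 unitVol) :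
    MemLp (dilAvg (fun t => t * density d t) g) 2 unitVol := by
  obtain ⟨M, -, hM⟩ := exists_abs_density_le hd
  exact memLp_dilAvg (measurable_id.mul (measurable_density d)) hM hg

lemma hasWeakDeriv_slicing_cosSum_sub {d : ℕ} (hd : 3 ≤ d) {F G : ℝ → ℝ}
    (hF : MemLp F 2 unitVol) (hG : MemLp G 2 unitVol) (hFG : HasWeakDeriv 0 1 1 F G) {K : ℕ}
    (b : Fin K → ℝ) : HasWeakDeriv 0 1 1 (fun s => slicing d (cosSum b) s - F s)
      (fun s => dilAvg (fun t => t * density d t) (cosSumDeriv b) s - G s) :=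
  (hasWeakDeriv_slicing_cosSum hd b).sub hFG
    (memLp_slicing hd ((continuous_cosSum b).memLp_Ioo 0 1))
    (memLp_dilAvg_mul_density hd ((continuous_cosSumDeriv b).memLp_Ioo 0 1)) hF hG

theorem existsUnique_isMinimizer_h1Norm {d : ℕ} (hd : 3 ≤ d) {F G : ℝ → ℝ}
    (hF : MemLp F 2 unitVol) (hG : MemLp G 2 unitVol) (hFG : HasWeakDeriv 0 1 1 F G) (K : ℕ) :
    ∃! a : Fin K → ℝ, IsMinimizer h1Norm d F a := by
  obtain ⟨M, hM, hM'⟩ := exists_abs_density_le hd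
  have hw := measurable_density d
  have hw' : Measurable fun t => t * density d t := measurable_id.mul hw
  have hc := fun k : Fin K => (continuous_cosBasis k).memLp_Ioo 0 1
  have hc' := fun k : Fin K => (continuous_cosBasisDeriv k).memLp_Ioo 0 1
  have hp := fun k => memLp_dilAvg hw hM (hc k)
  have hp' := fun k => memLp_dilAvg hw' hM' (hc' k)
  -- The `H¹` problem becomes least squares in `L² × L²` by pairing each function with its weak
  -- derivative. The first components are already independent.
  set P : Fin K → WithLp 2 (Lp ℝ 2 unitVol × Lp ℝ 2 unitVol) := fun k =>
    WithLp.toLp 2 ((hp k).toLp, (hp' k).toLp)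
  have hP : LinearIndependent ℝ P := by
    refine LinearIndependent.of_comp
      (WithLp.fstₗ 2 ℝ (Lp ℝ 2 unitVol) (Lp ℝ 2 unitVol)) ?_
    exact linearIndependent_toLp_dilAvg hd hp
  have h := existsUnique_leastSquares hP (WithLp.toLp 2 (hF.toLp, hG.toLp))
  have hN : ∀ b : Fin K → ℝ, ‖∑ k, b k • P k - WithLp.toLp 2 (hF.toLp, hG.toLp)‖ ^ 2 =
      h1Norm (fun s => slicing d (cosSum b) s - F s) ^ 2 := fun b => by
    rw [h1Norm_sq (hasWeakDeriv_slicing_cosSum_sub hd hF hG hFG b), WithLp.prod_norm_sq_eq_of_L2]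
    have e1 := norm_sum_toLp_sub_sq hp hF b
    have e2 := norm_sum_toLp_sub_sq hp' hG b
    have e3 : (∑ k, b k • P k - WithLp.toLp 2 (hF.toLp, hG.toLp)).fst =
        ∑ k, b k • (hp k).toLp - hF.toLp :=
      congrArg (· - hF.toLp) (map_sum (WithLp.fstₗ 2 ℝ (Lp ℝ 2 unitVol) (Lp ℝ 2 unitVol)) _ _)
    have e4 : (∑ k, b k • P k - WithLp.toLp 2 (hF.toLp, hG.toLp)).snd =
        ∑ k, b k • (hp' k).toLp - hG.toLp :=
      congrArg (· - hG.toLp) (map_sum (WithLp.sndₗ 2 ℝ (Lp ℝ 2 unitVol) (Lp ℝ 2 unitVol)) _ _)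
    rw [e3, e4, e1, e2]
    congr 1 <;> refine setIntegral_congr_fun measurableSet_Ioo fun s hs => ?_
    · change _ = (dilAvg (density d) (fun t => ∑ k, b k * cosBasis k t) s - F s) ^ 2
      rw [dilAvg_sum hw hM hc b hs]
    · change _ = (dilAvg (fun t => t * density d t)
        (fun t => ∑ k, b k * cosBasisDeriv k t) s - G s) ^ 2
      rw [dilAvg_sum hw' hM' hc' b hs]
  simpa only [IsMinimizer, hN] using h

/-! ### Fourier analysis on the circle of length `2` -/

/-- Lebesgue measure on `(-1,1)`. -/
noncomputable abbrev symVol : Measure ℝ := volume.restrict (Ioo (-1 : ℝ) 1)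

/-- The unnormalised cosine coefficients on `(-1,1)`. -/
noncomputable def cosCoeff (g : ℝ → ℝ) (n : ℤ) : ℝ := ∫ x, g x * Real.cos (Real.pi * n * x) ∂symVol

/-- The unnormalised sine coefficients on `(-1,1)`. -/
noncomputable def sinCoeff (g : ℝ → ℝ) (n : ℤ) : ℝ := ∫ x, g x * Real.sin (Real.pi * n * x) ∂symVol

/-- The energy of `g` at frequency `n`. -/
noncomputable def energy (g : ℝ → ℝ) (n : ℤ) : ℝ := cosCoeff g n ^ 2 + sinCoeff g n ^ 2

lemma energy_nonneg (g : ℝ → ℝ) (n : ℤ) : 0 ≤ energy g n := by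
  unfold energy
  positivity

lemma integrable_mul_cos {g : ℝ → ℝ} (hg : MemLp g 2 symVol) (c : ℝ) :
    Integrable (fun x => g x * Real.cos (c * x)) symVol :=
  (hg.integrable one_le_two).mul_bdd (c := 1)
    (Continuous.aestronglyMeasurable (by fun_prop))
    (ae_of_all _ fun x => Real.abs_cos_le_one _)

lemma integrable_mul_sin {g : ℝ → ℝ} (hg : MemLp g 2 symVol) (c : ℝ) :
    Integrable (fun x => g x * Real.sin (c * x)) symVol :=
  (hg.integrable one_le_two).mul_bdd (c := 1)
    (Continuous.aestronglyMeasurable (by fun_prop))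
    (ae_of_all _ fun x => Real.abs_sin_le_one _)

lemma cosCoeff_sub {g g' : ℝ → ℝ} (hg : MemLp g 2 symVol) (hg' : MemLp g' 2 symVol) (n : ℤ) :
    cosCoeff (fun x => g x - g' x) n = cosCoeff g n - cosCoeff g' n := by
  simp only [cosCoeff, sub_mul]
  exact integral_sub (integrable_mul_cos hg _) (integrable_mul_cos hg' _)

lemma sinCoeff_sub {g g' : ℝ → ℝ} (hg : MemLp g 2 symVol) (hg' : MemLp g' 2 symVol) (n : ℤ) :
    sinCoeff (fun x => g x - g' x) n = sinCoeff g n - sinCoeff g' n := by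
  simp only [sinCoeff, sub_mul]
  exact integral_sub (integrable_mul_sin hg _) (integrable_mul_sin hg' _)

/-- Parseval's identity for a real function on `(-1,1)`. -/
lemma hasSum_energy {g : ℝ → ℝ} (hg : MemLp g 2 symVol) :
    HasSum (energy g) (2 * ∫ x, g x ^ 2 ∂symVol) := by
  have h11 : (-1 : ℝ) < 1 := by norm_num
  have hg' : MemLp (fun x => (g x : ℂ)) 2 (volume.restrict (Ioc (-1 : ℝ) 1)) := by
    rw [restrict_Ioo_eq_restrict_Ioc.symm]
    exact hg.ofReal
  have h := (hasSum_sq_fourierCoeffOn h11 hg').mul_left 4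
  have hc : ∀ n : ℤ, 4 * ‖fourierCoeffOn h11 (fun x => (g x : ℂ)) n‖ ^ 2 = energy g n := by
    intro n
    -- The interval has length `2`, so the normalised complex coefficient carries a factor `1/2`;
    -- this accounts for the `4` above.
    have e1 : fourierCoeffOn h11 (fun x => (g x : ℂ)) n =
        (1 / 2 : ℝ) • ((cosCoeff g n : ℂ) - (sinCoeff g n : ℂ) * Complex.I) := by
      rw [fourierCoeffOn_eq_integral, intervalIntegral.integral_of_le h11.le,
        integral_Ioc_eq_integral_Ioo, cosCoeff, sinCoeff, ← integral_complex_ofReal, ← integral_complex_ofReal,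
        ← integral_mul_const, ← integral_sub (integrable_mul_cos hg _).ofReal
          ((integrable_mul_sin hg _).ofReal.mul_const _)]
      congr 1
      · norm_num
      · refine integral_congr_ae (ae_of_all _ fun x => ?_)
        simp only [fourier_coe_apply, smul_eq_mul]
        have e2 : 2 * (Real.pi : ℂ) * Complex.I * ((-n : ℤ) : ℂ) * (x : ℂ) / ((1 - -1 : ℝ) : ℂ) =
            ((-(Real.pi * n * x) : ℝ) : ℂ) * Complex.I := by
          push_cast
          ring
        rw [e2, Complex.exp_mul_I, ← Complex.ofReal_cos, ← Complex.ofReal_sin, Real.cos_neg,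
          Real.sin_neg]
        push_cast
        ring
    rw [e1, norm_smul, mul_pow, Complex.sq_norm, Complex.normSq_apply]
    simp [energy]
    ring
  have e : 4 * ((1 - -1 : ℝ)⁻¹ • ∫ x in (-1 : ℝ)..1, ‖(g x : ℂ)‖ ^ 2) =
      2 * ∫ x, g x ^ 2 ∂symVol := by
    rw [intervalIntegral.integral_of_le h11.le, integral_Ioc_eq_integral_Ioo]
    simp only [Complex.norm_real, Real.norm_eq_abs, sq_abs, smul_eq_mul]
    ring
  rw [e] at h
  simpa only [hc] using h

lemma mul_integral_sq_le_of_energy_le {g W : ℝ → ℝ} (hg : MemLp g 2 symVol)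
    (hW : MemLp W 2 symVol) {c : ℝ} (h : ∀ n, c * energy g n ≤ energy W n) :
    c * ∫ x, g x ^ 2 ∂symVol ≤ ∫ x, W x ^ 2 ∂symVol := by
  have := hasSum_le h ((hasSum_energy hg).mul_left c) (hasSum_energy hW)
  linarith

/-- `v` is the weak derivative of `u` on the circle `ℝ / 2ℤ`. -/
def HasPeriodicWeakDeriv (u v : ℝ → ℝ) : Prop :=
  ∀ φ : ℝ → ℝ, ContDiff ℝ ∞ φ → φ (-1) = φ 1 →
    ∫ x, u x * deriv φ x ∂symVol = -∫ x, v x * φ x ∂symVol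

/-- Periodic test functions need not vanish at `±1`, so the trigonometric functions are themselves
admissible. -/
lemma HasPeriodicWeakDeriv.cosCoeff_eq {u v : ℝ → ℝ} (h : HasPeriodicWeakDeriv u v) (n : ℤ) :
    cosCoeff v n = Real.pi * n * sinCoeff u n := by
  have hd : deriv (fun x => Real.cos (Real.pi * n * x)) =
      fun x => -(Real.pi * n * Real.sin (Real.pi * n * x)) := by
    ext x
    refine ((hasDerivAt_id x).const_mul (Real.pi * n)).cos.deriv.trans ?_
    simp only [id_eq]
    ring
  have e := h (fun x => Real.cos (Real.pi * n * x)) (by fun_prop) (by simp)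
  simp only [hd, mul_neg, integral_neg, neg_inj, mul_left_comm (u _), integral_const_mul] at e
  exact e.symm

lemma HasPeriodicWeakDeriv.sinCoeff_eq {u v : ℝ → ℝ} (h : HasPeriodicWeakDeriv u v) (n : ℤ) :
    sinCoeff v n = -(Real.pi * n * cosCoeff u n) := by
  have hd : deriv (fun x => Real.sin (Real.pi * n * x)) =
      fun x => Real.pi * n * Real.cos (Real.pi * n * x) := by
    ext x
    refine ((hasDerivAt_id x).const_mul (Real.pi * n)).sin.deriv.trans ?_
    simp only [id_eq]
    ring
  have hs : Real.sin (Real.pi * n) = 0 := by rw [mul_comm]; exact Real.sin_int_mul_pi n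
  have e := h (fun x => Real.sin (Real.pi * n * x)) (by fun_prop) (by simp [hs])
  simp only [hd, mul_left_comm (u _), integral_const_mul] at e
  rw [sinCoeff, cosCoeff, e, neg_neg]

lemma HasPeriodicWeakDeriv.energy_eq {u v : ℝ → ℝ} (h : HasPeriodicWeakDeriv u v) (n : ℤ) :
    energy v n = (Real.pi * n) ^ 2 * energy u n := by
  rw [energy, h.cosCoeff_eq, h.sinCoeff_eq, energy]
  ring

lemma energy_chain {W : ℕ → ℝ → ℝ} {r : ℕ}
    (h : ∀ j < r, HasPeriodicWeakDeriv (W j) (W (j + 1))) (n : ℤ) :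
    energy (W r) n = ((Real.pi * n) ^ 2) ^ r * energy (W 0) n := by
  induction r with
  | zero => simp
  | succ r ih =>
    rw [(h r r.lt_succ_self).energy_eq, ih fun j hj => h j (hj.trans r.lt_succ_self)]
    ring

lemma sinCoeff_of_even {u : ℝ → ℝ} (hu : ∀ x, u (-x) = u x) (n : ℤ) : sinCoeff u n = 0 := by
  have h11 : (-1 : ℝ) ≤ 1 := by norm_num
  have e : sinCoeff u n = ∫ x in (-1 : ℝ)..1, u x * Real.sin (Real.pi * n * x) := by
    rw [intervalIntegral.integral_of_le h11, integral_Ioc_eq_integral_Ioo, sinCoeff]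
  have e2 := intervalIntegral.integral_comp_neg (a := -1) (b := 1)
    (fun x => u x * Real.sin (Real.pi * n * x))
  simp only [hu, mul_neg, Real.sin_neg, intervalIntegral.integral_neg, neg_neg] at e2
  rw [e]
  linarith

lemma integral_cos_pi_mul (m : ℤ) :
    ∫ x, Real.cos (Real.pi * m * x) ∂symVol = if m = 0 then 2 else 0 := by
  have h11 : (-1 : ℝ) ≤ 1 := by norm_num
  rw [← integral_Ioc_eq_integral_Ioo, ← intervalIntegral.integral_of_le h11]
  split_ifs with hm
  · subst hm
    simp
    norm_num
  · have hm' : Real.pi * m ≠ 0 := mul_ne_zero Real.pi_ne_zero (by exact_mod_cast hm)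
    have hs : Real.sin (Real.pi * m) = 0 := by rw [mul_comm]; exact Real.sin_int_mul_pi m
    rw [intervalIntegral.integral_comp_mul_left (fun x => Real.cos x) hm', integral_cos]
    simp [hs]

/-- The squared `L²(-1,1)` norm of `cosBasis k`, divided by its value at `0`. -/
noncomputable def cosWeight (k : ℕ) : ℝ := if k = 0 then 2 else Real.sqrt 2

lemma cosWeight_ne_zero (k : ℕ) : cosWeight k ≠ 0 := by
  unfold cosWeight
  split_ifs <;> simp

lemma cosCoeff_cosBasis (k : ℕ) (n : ℤ) :
    cosCoeff (cosBasis k) n = if n.natAbs = k then cosWeight k else 0 := by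
  rcases eq_or_ne k 0 with rfl | hk
  · simp only [cosCoeff, cosBasis, if_true, one_mul, integral_cos_pi_mul, Int.natAbs_eq_zero,
      cosWeight]
  · have e : ∀ x, cosBasis k x * Real.cos (Real.pi * n * x) = Real.sqrt 2 / 2 *
        (Real.cos (Real.pi * (k + n : ℤ) * x) + Real.cos (Real.pi * (k - n : ℤ) * x)) := by
      intro x
      have h1 : Real.pi * (k + n : ℤ) * x = Real.pi * k * x + Real.pi * n * x := by
        push_cast; ring
      have h2 : Real.pi * (k - n : ℤ) * x = Real.pi * k * x - Real.pi * n * x := by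
        push_cast; ring
      rw [h1, h2, Real.cos_add, Real.cos_sub, cosBasis, if_neg hk]
      ring
    have hi : ∀ m : ℤ, Integrable (fun x => Real.cos (Real.pi * m * x)) symVol := fun m =>
      ((show Continuous fun x => Real.cos (Real.pi * m * x) by fun_prop).memLp_Ioo
        (-1) 1).integrable one_le_two
    simp only [cosCoeff, e]
    rw [integral_const_mul, integral_add (hi _) (hi _), integral_cos_pi_mul, integral_cos_pi_mul,
      cosWeight, if_neg hk]
    by_cases h : n.natAbs = k
    · rcases Int.natAbs_eq n with h' | h'
      · rw [if_neg (by omega), if_pos (by omega), if_pos h]; ring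
      · rw [if_pos (by omega), if_neg (by omega), if_pos h]; ring
    · rw [if_neg (by omega), if_neg (by omega), if_neg h]; ring

lemma cosCoeff_cosSum {K : ℕ} (b : Fin K → ℝ) (n : ℤ) :
    cosCoeff (cosSum b) n =
      if h : n.natAbs < K then b ⟨n.natAbs, h⟩ * cosWeight n.natAbs else 0 := by
  have e : cosCoeff (cosSum b) n = ∑ k : Fin K, b k * cosCoeff (cosBasis k) n := by
    simp only [cosCoeff, cosSum, Finset.sum_mul]
    rw [integral_finsetSum]
    · refine Finset.sum_congr rfl fun k _ => ?_
      rw [← integral_const_mul]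
      exact integral_congr_ae (ae_of_all _ fun x => mul_assoc _ _ _)
    · intro k _
      refine ((integrable_mul_cos ((continuous_cosBasis k).memLp_Ioo (-1) 1)
        (Real.pi * n)).const_mul (b k)).congr (ae_of_all _ fun x => (mul_assoc _ _ _).symm)
  rw [e]
  simp only [cosCoeff_cosBasis]
  split_ifs with h
  · rw [Finset.sum_eq_single ⟨n.natAbs, h⟩]
    · simp
    · intro k _ hk
      rw [if_neg (fun h' => hk (Fin.ext h'.symm)), mul_zero]
    · simp
  · refine Finset.sum_eq_zero fun k _ => ?_
    rw [if_neg (by have := k.2; omega), mul_zero]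

lemma cosSum_neg {K : ℕ} (b : Fin K → ℝ) (x : ℝ) : cosSum b (-x) = cosSum b x := by
  simp [cosSum, cosBasis]

/-- The boundary terms of the integration by parts cancel because the cosine sum is even and `φ (-1)
= φ 1`. -/
lemma hasPeriodicWeakDeriv_cosSum {K : ℕ} (b : Fin K → ℝ) :
    HasPeriodicWeakDeriv (cosSum b) (cosSumDeriv b) := by
  intro φ hφ hφ1
  have h11 : (-1 : ℝ) ≤ 1 := by norm_num
  have hd := hφ.continuous_deriv (by simp)
  simp only [← integral_Ioc_eq_integral_Ioo]
  rw [← intervalIntegral.integral_of_le h11, ← intervalIntegral.integral_of_le h11,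
    intervalIntegral.integral_mul_deriv_eq_deriv_mul (fun x _ => hasDerivAt_cosSum b x)
      (fun x _ => (hφ.differentiable (by simp)).differentiableAt.hasDerivAt)
      ((continuous_cosSumDeriv b).intervalIntegrable _ _) (hd.intervalIntegrable _ _),
    hφ1, cosSum_neg]
  ring

lemma HasPeriodicWeakDeriv.sub {u v u' v' : ℝ → ℝ} (h : HasPeriodicWeakDeriv u v)
    (h' : HasPeriodicWeakDeriv u' v') (hu : MemLp u 2 symVol) (hv : MemLp v 2 symVol)
    (hu' : MemLp u' 2 symVol) (hv' : MemLp v' 2 symVol) :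
    HasPeriodicWeakDeriv (fun x => u x - u' x) (fun x => v x - v' x) := by
  intro φ hφ hφ1
  have hint : ∀ {u ψ : ℝ → ℝ}, MemLp u 2 symVol → Continuous ψ →
      Integrable (fun x => u x * ψ x) symVol := fun hu hψ =>
    MemLp.integrable_mul hu (hψ.memLp_Ioo (-1) 1)
  have hd := hφ.continuous_deriv (by simp)
  have hc := hφ.continuous
  simp only [sub_mul]
  rw [integral_sub (hint hu hd) (hint hu' hd), integral_sub (hint hv hc) (hint hv' hc),
    h φ hφ hφ1, h' φ hφ hφ1]
  ring

/-- Truncating the cosine series of an even function which has `r` weak derivatives on the circle: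
error bounds for the function and for its derivative. -/
lemma exists_cosSum_approx {r : ℕ} (hr : 1 ≤ r) {W : ℕ → ℝ → ℝ} (hW : ∀ j, MemLp (W j) 2 symVol)
    (hchain : ∀ j < r, HasPeriodicWeakDeriv (W j) (W (j + 1))) (heven : ∀ x, W 0 (-x) = W 0 x)
    (K : ℕ) : ∃ b : Fin K → ℝ,
      (K : ℝ) ^ (2 * r) * ∫ x, (W 0 x - cosSum b x) ^ 2 ∂symVol ≤ ∫ x, W r x ^ 2 ∂symVol ∧
      (K : ℝ) ^ (2 * (r - 1)) * ∫ x, (W 1 x - cosSumDeriv b x) ^ 2 ∂symVol ≤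
        ∫ x, W r x ^ 2 ∂symVol := by
  -- The cosine coefficients of `W 0`: the error then has no frequencies below `K`, and from `K` on
  -- it has those of `W 0`.
  set b : Fin K → ℝ := fun k => cosCoeff (W 0) (k : ℕ) / cosWeight k
  have hs := (continuous_cosSum b).memLp_Ioo (-1) 1
  have hs' := (continuous_cosSumDeriv b).memLp_Ioo (-1) 1
  have habs : ∀ n : ℤ, cosCoeff (W 0) n.natAbs = cosCoeff (W 0) n := fun n => by
    rcases Int.natAbs_eq n with h | h
    · rw [← h]
    · nth_rewrite 2 [h]
      simp [cosCoeff]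
  have hlow : ∀ n : ℤ, n.natAbs < K → energy (fun x => W 0 x - cosSum b x) n = 0 := fun n hn => by
    rw [energy, cosCoeff_sub (hW 0) hs, sinCoeff_sub (hW 0) hs, sinCoeff_of_even heven,
      sinCoeff_of_even (cosSum_neg b), cosCoeff_cosSum, dif_pos hn]
    simp only [b, div_mul_cancel₀ _ (cosWeight_ne_zero _), habs]
    ring
  have hhigh : ∀ n : ℤ, ¬ n.natAbs < K →
      energy (fun x => W 0 x - cosSum b x) n = energy (W 0) n := fun n hn => by
    rw [energy, cosCoeff_sub (hW 0) hs, sinCoeff_sub (hW 0) hs,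
      sinCoeff_of_even (cosSum_neg b), cosCoeff_cosSum, dif_neg hn, energy]
    ring
  have hKn : ∀ n : ℤ, ¬ n.natAbs < K → (K : ℝ) ^ 2 ≤ (Real.pi * n) ^ 2 := fun n hn => by
    have h1 : (K : ℝ) ≤ |(n : ℝ)| := by
      rw [← Int.cast_abs, Int.abs_eq_natAbs]
      exact_mod_cast not_lt.1 hn
    rw [← sq_abs (Real.pi * n), abs_mul, abs_of_pos Real.pi_pos]
    have h2 : (K : ℝ) ≤ Real.pi * |(n : ℝ)| := by
      nlinarith [Real.pi_gt_three, abs_nonneg (n : ℝ)]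
    gcongr
  refine ⟨b, mul_integral_sq_le_of_energy_le (g := fun x => W 0 x - cosSum b x)
    ((hW 0).sub hs) (hW r) fun n => ?_,
    mul_integral_sq_le_of_energy_le (g := fun x => W 1 x - cosSumDeriv b x)
    ((hW 1).sub hs') (hW r) fun n => ?_⟩
  · by_cases hn : n.natAbs < K
    · rw [hlow n hn, mul_zero]
      exact energy_nonneg _ _
    · rw [hhigh n hn, energy_chain hchain, pow_mul]
      have := hKn n hn
      have := energy_nonneg (W 0) n
      gcongr
  · have h1 : HasPeriodicWeakDeriv (fun x => W 0 x - cosSum b x)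
        (fun x => W 1 x - cosSumDeriv b x) :=
      (hchain 0 (by omega)).sub (hasPeriodicWeakDeriv_cosSum b) (hW 0) (hW 1) hs hs'
    rw [h1.energy_eq]
    by_cases hn : n.natAbs < K
    · rw [hlow n hn, mul_zero, mul_zero]
      exact energy_nonneg _ _
    · rw [hhigh n hn, energy_chain hchain, pow_mul, ← mul_assoc]
      have := hKn n hn
      have := energy_nonneg (W 0) n
      gcongr
      -- The derivative uses up one of the `r` factors `(π n)²`; the other `r - 1` are compared with
      -- `K²`.
      obtain ⟨m, rfl⟩ : ∃ m, r = m + 1 := ⟨r - 1, by omega⟩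
      rw [Nat.add_sub_cancel, pow_succ ((Real.pi * (n : ℝ)) ^ 2) m]
      gcongr

/-! ### Smooth cutoffs -/

/-- A smooth step, `0` on `(-∞,1/2]` and `1` on `[1,∞)`. -/
noncomputable def smoothStep (y : ℝ) : ℝ := Real.smoothTransition (2 * y - 1)

lemma contDiff_smoothStep : ContDiff ℝ ∞ smoothStep :=
  Real.smoothTransition.contDiff.comp (by fun_prop)

lemma smoothStep_of_le {y : ℝ} (hy : y ≤ 1 / 2) : smoothStep y = 0 :=
  Real.smoothTransition.zero_of_nonpos (by linarith)

lemma smoothStep_of_one_le {y : ℝ} (hy : 1 ≤ y) : smoothStep y = 1 :=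
  Real.smoothTransition.one_of_one_le (by linarith)

lemma hasCompactSupport_deriv_smoothStep : HasCompactSupport (deriv smoothStep) := by
  refine HasCompactSupport.of_support_subset_isCompact (isCompact_Icc (a := (0 : ℝ)) (b := 1)) ?_
  intro y hy
  by_contra h
  refine hy ?_
  rcases not_and_or.1 h with h0 | h1
  · have : smoothStep =ᶠ[nhds y] fun _ => 0 :=
      Filter.eventuallyEq_of_mem (Iio_mem_nhds (not_le.1 h0)) fun z hz =>
        smoothStep_of_le (by have : z < 0 := hz; linarith)
    rw [this.deriv_eq, deriv_const]
  · have : smoothStep =ᶠ[nhds y] fun _ => 1 :=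
      Filter.eventuallyEq_of_mem (Ioi_mem_nhds (not_le.1 h1)) fun z hz =>
        smoothStep_of_one_le (le_of_lt hz)
    rw [this.deriv_eq, deriv_const]

lemma exists_bound_iteratedDeriv_smoothStep (i : ℕ) :
    ∃ B, ∀ y, |iteratedDeriv i smoothStep y| ≤ B := by
  cases i with
  | zero =>
    refine ⟨1, fun y => ?_⟩
    rw [iteratedDeriv_zero, smoothStep, abs_of_nonneg (Real.smoothTransition.nonneg _)]
    exact Real.smoothTransition.le_one _
  | succ i =>
    rw [iteratedDeriv_succ']
    have hc : HasCompactSupport (iteratedDeriv i (deriv smoothStep)) := by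
      induction i with
      | zero => simpa using hasCompactSupport_deriv_smoothStep
      | succ i ih => rw [iteratedDeriv_succ]; exact ih.deriv
    refine Continuous.bounded_above_of_compact_support ?_ hc
    rw [← iteratedDeriv_succ']
    exact contDiff_smoothStep.continuous_iteratedDeriv _ (by exact_mod_cast le_top)

lemma iteratedDeriv_comp_affine {f : ℝ → ℝ} (hf : ContDiff ℝ ∞ f) (i : ℕ) (c e : ℝ) :
    iteratedDeriv i (fun x => f (c * x + e)) =
      fun x => c ^ i * iteratedDeriv i f (c * x + e) := by
  have h : ContDiff ℝ i fun z => f (z + e) :=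
    (hf.of_le (by exact_mod_cast le_top)).comp (by fun_prop)
  have h2 := iteratedDeriv_comp_const_mul h c
  rw [iteratedDeriv_comp_add_const] at h2
  exact h2

/-- Even cutoffs at distance `ε` from `±1`, with the expected bounds on the derivatives. -/
lemma exists_cutoff (n : ℕ) : ∃ B : ℝ, 0 ≤ B ∧ ∀ ε ∈ Ioc (0 : ℝ) 1, ∃ χ : ℝ → ℝ,
    ContDiff ℝ ∞ χ ∧ HasCompactSupport χ ∧ tsupport χ ⊆ Ioo (-1) 1 ∧ (∀ x, χ (-x) = χ x) ∧
    (∀ x ∈ Ioo 0 (1 - ε), χ x = 1) ∧ ∀ i ≤ n, ∀ x, |iteratedDeriv i χ x| ≤ B * ε⁻¹ ^ i := by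
  choose B hB using exists_bound_iteratedDeriv_smoothStep
  have hB0 : ∀ i, 0 ≤ B i := fun i => (abs_nonneg _).trans (hB i 0)
  -- Each derivative order needs `2 * B i + 1`: two rescaled steps and the subtracted constant. The
  -- sum bounds all orders up to `n` at once.
  refine ⟨∑ i ∈ Finset.range (n + 1), (2 * B i + 1), Finset.sum_nonneg fun i _ => by
    have := hB0 i; positivity, fun ε hε => ?_⟩
  have hε0 := hε.1
  have hinv : 1 ≤ ε⁻¹ := (one_le_inv₀ hε0).2 hε.2
  set p : ℝ → ℝ := fun x => smoothStep (ε⁻¹ * x + ε⁻¹)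
  set q : ℝ → ℝ := fun x => smoothStep (-ε⁻¹ * x + ε⁻¹)
  have hp : ContDiff ℝ ∞ p := contDiff_smoothStep.comp (by fun_prop)
  have hq : ContDiff ℝ ∞ q := contDiff_smoothStep.comp (by fun_prop)
  have hp1 : ∀ x, 0 ≤ x → p x = 1 := fun x hx =>
    smoothStep_of_one_le (by have := mul_nonneg (zero_le_one.trans hinv) hx; linarith)
  have hqp : ∀ x, q x = p (-x) := fun x => by simp [p, q]
  have hpq : ∀ x, p x = q (-x) := fun x => by simp [p, q]
  have hq0 : ∀ x, 1 - ε / 2 ≤ x → q x = 0 := fun x hx => smoothStep_of_le (by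
    have h1 : ε⁻¹ * (1 - x) ≤ ε⁻¹ * (ε / 2) := by gcongr; linarith
    have h2 : ε⁻¹ * (ε / 2) = 1 / 2 := by field_simp
    linarith)
  have hq1 : ∀ x, x ≤ 1 - ε → q x = 1 := fun x hx => smoothStep_of_one_le (by
    have h1 : ε⁻¹ * ε ≤ ε⁻¹ * (1 - x) := by gcongr; linarith
    have h2 : ε⁻¹ * ε = 1 := by field_simp
    linarith)
  -- Here `p` rises near `-1` and its mirror image `q` falls near `1`; at every point at least one
  -- of them equals `1`, so the sum minus `1` is the cutoff.
  set χ : ℝ → ℝ := fun x => p x + q x - 1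
  have hχ : ContDiff ℝ ∞ χ := (hp.add hq).sub contDiff_const
  have heven : ∀ x, χ (-x) = χ x := fun x => by
    simp only [χ]; rw [← hqp, ← hpq]; ring
  have h0 : ∀ x, 1 - ε / 2 ≤ x → χ x = 0 := fun x hx => by
    simp only [χ]
    rw [hp1 x (by linarith [hε.2]), hq0 x hx]
    ring
  have hsupp : Function.support χ ⊆ Icc (-(1 - ε / 2)) (1 - ε / 2) := by
    intro x hx
    by_contra h
    refine hx ?_
    rcases not_and_or.1 h with h' | h'
    · rw [← heven]
      exact h0 _ (by linarith [not_le.1 h'])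
    · exact h0 _ (not_le.1 h').le
  refine ⟨χ, hχ, HasCompactSupport.of_support_subset_isCompact isCompact_Icc hsupp,
    (closure_minimal hsupp isClosed_Icc).trans
      (Icc_subset_Ioo (by linarith) (by linarith)), heven, fun x hx => ?_, fun i hi x => ?_⟩
  · simp only [χ]
    rw [hp1 x hx.1.le, hq1 x hx.2.le]
    ring
  · have e : iteratedDeriv i χ x = ε⁻¹ ^ i * iteratedDeriv i smoothStep (ε⁻¹ * x + ε⁻¹) +
        (-ε⁻¹) ^ i * iteratedDeriv i smoothStep (-ε⁻¹ * x + ε⁻¹) - if i = 0 then 1 else 0 := by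
      have hpi : ContDiffAt ℝ i p x := (hp.of_le (by exact_mod_cast le_top)).contDiffAt
      have hqi : ContDiffAt ℝ i q x := (hq.of_le (by exact_mod_cast le_top)).contDiffAt
      change iteratedDeriv i ((p + q) - fun _ => 1) x = _
      rw [iteratedDeriv_sub (f := p + q) (hpi.add hqi) contDiffAt_const, iteratedDeriv_add hpi hqi,
        iteratedDeriv_comp_affine contDiff_smoothStep, iteratedDeriv_comp_affine contDiff_smoothStep,
        iteratedDeriv_const]
    have h1 := hB i (ε⁻¹ * x + ε⁻¹)
    have h2 := hB i (-ε⁻¹ * x + ε⁻¹)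
    have h3 : (1 : ℝ) ≤ ε⁻¹ ^ i := one_le_pow₀ hinv
    have h4 : |ε⁻¹ ^ i * iteratedDeriv i smoothStep (ε⁻¹ * x + ε⁻¹)| ≤ ε⁻¹ ^ i * B i := by
      rw [abs_mul, abs_of_nonneg (zero_le_one.trans h3)]
      gcongr
    have h5 : |(-ε⁻¹) ^ i * iteratedDeriv i smoothStep (-ε⁻¹ * x + ε⁻¹)| ≤ ε⁻¹ ^ i * B i := by
      rw [abs_mul, abs_pow, abs_neg, abs_of_pos (inv_pos.2 hε0)]
      gcongr
    have h6 : |(if i = 0 then 1 else 0 : ℝ)| ≤ 1 := by split_ifs <;> simp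
    have h7 : 2 * B i + 1 ≤ ∑ i ∈ Finset.range (n + 1), (2 * B i + 1) :=
      Finset.single_le_sum (f := fun i => 2 * B i + 1)
        (fun j _ => by have := hB0 j; positivity) (Finset.mem_range.2 (by omega))
    rw [e]
    calc _ ≤ ε⁻¹ ^ i * B i + ε⁻¹ ^ i * B i + 1 :=
          (abs_sub _ _).trans (add_le_add ((abs_add_le _ _).trans (add_le_add h4 h5)) h6)
      _ ≤ (2 * B i + 1) * ε⁻¹ ^ i := by linarith
      _ ≤ _ := by gcongr

/-! ### Cutting off a Sobolev function -/

/-- A chain of weak derivatives of `u`, starting with `u` itself. -/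
lemma MemSobolev.exists_derivs {a b : ℝ} {r : ℕ} {u : ℝ → ℝ} (h : MemSobolev a b r u) :
    ∃ v : ℕ → ℝ → ℝ, v 0 = u ∧ (∀ k, MemLp (v k) 2 (volume.restrict (Ioo a b))) ∧
      ∀ k ≤ r, HasWeakDeriv a b k u (v k) := by
  -- The sequence is made total: order `0` is `u` exactly, not just up to null sets, and orders
  -- beyond `r` get the default `0`.
  have hex : ∀ k, ∃ v : ℝ → ℝ, (k = 0 → v = u) ∧ MemLp v 2 (volume.restrict (Ioo a b)) ∧
      (k ≤ r → HasWeakDeriv a b k u v) := fun k => by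
    rcases eq_or_ne k 0 with rfl | hk
    · exact ⟨u, fun _ => rfl, h.1, fun _ => ⟨locallyIntegrableOn_of_memLp h.1,
        locallyIntegrableOn_of_memLp h.1, fun φ _ _ _ => by simp⟩⟩
    · by_cases hkr : k ≤ r
      · obtain ⟨v, hv, hv'⟩ := h.2 k hkr
        exact ⟨v, fun h => absurd h hk, hv, fun _ => hv'⟩
      · exact ⟨0, fun h => absurd h hk, MemLp.zero, fun h => absurd h hkr⟩
  choose v h0 h1 h2 using hex
  exact ⟨v, h0 0 rfl, h1, h2⟩

/-- If `φ` is a test function, so is `deriv φ`; testing the `k`-th derivative with it reproduces the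
definition of order `k + 1`. -/
lemma HasWeakDeriv.succ {a b : ℝ} {k : ℕ} {u v w : ℝ → ℝ} (hv : HasWeakDeriv a b k u v)
    (hw : HasWeakDeriv a b (k + 1) u w) : HasWeakDeriv a b 1 v w := by
  refine ⟨hv.2.1, hw.2.1, fun φ hφ hφc hφs => ?_⟩
  have hφ' : ContDiff ℝ ∞ (deriv φ) := by
    simpa using ContDiff.iterate_deriv 1 hφ
  have e1 := hv.2.2 (deriv φ) hφ' hφc.deriv ((tsupport_deriv_subset).trans hφs)
  have e2 := hw.2.2 φ hφ hφc hφs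
  rw [iteratedDeriv_succ', e1, pow_succ, mul_assoc] at e2
  rw [iteratedDeriv_one, pow_one]
  exact mul_left_cancel₀ (pow_ne_zero k (by norm_num)) e2

/-- Leibniz' rule against a cutoff `η` supported in `(-1,1)`, tested against a smooth function. -/
lemma HasWeakDeriv.integral_mul_cutoff {v v' η φ : ℝ → ℝ} (h : HasWeakDeriv (-1) 1 1 v v')
    (hv : MemLp v 2 symVol) (hη : ContDiff ℝ ∞ η) (hηc : HasCompactSupport η) (hηs : tsupport η ⊆ Ioo (-1) 1)
    (hφ : ContDiff ℝ ∞ φ) :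
    ∫ x, η x * v x * deriv φ x ∂symVol =
      -(∫ x, η x * v' x * φ x ∂symVol + ∫ x, deriv η x * v x * φ x ∂symVol) := by
  have hd : ∀ x, deriv (fun x => η x * φ x) x = deriv η x * φ x + η x * deriv φ x := fun x =>
    deriv_fun_mul (hη.differentiable (by simp)).differentiableAt
      (hφ.differentiable (by simp)).differentiableAt
  -- The product `η φ` has compact support in `(-1,1)` even though `φ` is not required to vanish at
  -- `±1`.
  have e := h.2.2 (fun x => η x * φ x) (hη.mul hφ) hηc.mul_right
    ((tsupport_mul_subset_left).trans hηs)
  have hηd := hη.continuous_deriv (by simp)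
  have hφd := hφ.continuous_deriv (by simp)
  simp only [iteratedDeriv_one, hd, mul_add, pow_one] at e
  have i1 : Integrable (fun x => v x * (deriv η x * φ x)) symVol :=
    MemLp.integrable_mul hv ((hηd.mul hφ.continuous).memLp_Ioo (-1) 1)
  have i2 : Integrable (fun x => v x * (η x * deriv φ x)) symVol :=
    MemLp.integrable_mul hv ((hη.continuous.mul hφd).memLp_Ioo (-1) 1)
  rw [integral_add i1 i2] at e
  have e1 : ∫ x, η x * v x * deriv φ x ∂symVol = ∫ x, v x * (η x * deriv φ x) ∂symVol :=
    integral_congr_ae (ae_of_all _ fun x => by ring)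
  have e2 : ∫ x, η x * v' x * φ x ∂symVol = ∫ x, v' x * (η x * φ x) ∂symVol :=
    integral_congr_ae (ae_of_all _ fun x => by ring)
  have e3 : ∫ x, deriv η x * v x * φ x ∂symVol = ∫ x, v x * (deriv η x * φ x) ∂symVol :=
    integral_congr_ae (ae_of_all _ fun x => by ring)
  rw [e1, e2, e3]
  linarith

/-- The `m`-th derivative of `χ u` according to Leibniz' rule, if `v j` is the `j`-th derivative
of `u`. -/
noncomputable def leibniz (χ : ℝ → ℝ) (v : ℕ → ℝ → ℝ) (m : ℕ) (x : ℝ) : ℝ :=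
  ∑ ij ∈ Finset.HasAntidiagonal.antidiagonal m, (m.choose ij.1 : ℝ) * (iteratedDeriv ij.1 χ x * v ij.2 x)

lemma memLp_mul_left {g u : ℝ → ℝ} (hg : Continuous g) (hgc : HasCompactSupport g)
    (hu : MemLp u 2 symVol) : MemLp (fun x => g x * u x) 2 symVol := by
  obtain ⟨C, hC⟩ := hg.bounded_above_of_compact_support hgc
  refine hu.of_le_mul (c := C) (hg.aestronglyMeasurable.mul hu.1) (ae_of_all _ fun x => ?_)
  rw [norm_mul]
  gcongr
  exact hC x

lemma hasCompactSupport_iteratedDeriv {χ : ℝ → ℝ} (hχ : HasCompactSupport χ) (i : ℕ) :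
    HasCompactSupport (iteratedDeriv i χ) := by
  induction i with
  | zero => simpa using hχ
  | succ i ih => rw [iteratedDeriv_succ]; exact ih.deriv

lemma tsupport_iteratedDeriv_subset (χ : ℝ → ℝ) (i : ℕ) :
    tsupport (iteratedDeriv i χ) ⊆ tsupport χ := by
  induction i with
  | zero => simp
  | succ i ih => rw [iteratedDeriv_succ]; exact tsupport_deriv_subset.trans ih

lemma contDiff_iteratedDeriv {χ : ℝ → ℝ} (hχ : ContDiff ℝ ∞ χ) (i : ℕ) :
    ContDiff ℝ ∞ (iteratedDeriv i χ) := by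
  rw [iteratedDeriv_eq_iterate]
  exact ContDiff.iterate_deriv i hχ

lemma memLp_leibniz {χ : ℝ → ℝ} {v : ℕ → ℝ → ℝ} (hχ : ContDiff ℝ ∞ χ)
    (hχc : HasCompactSupport χ) (hv : ∀ k, MemLp (v k) 2 symVol) (m : ℕ) :
    MemLp (leibniz χ v m) 2 symVol :=
  memLp_finsetSum _ fun ij _ => (memLp_mul_left (contDiff_iteratedDeriv hχ ij.1).continuous
    (hasCompactSupport_iteratedDeriv hχc ij.1) (hv ij.2)).const_mul _

/-- The cutoff removes all boundary contributions, so derivatives in the interior become derivatives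
on the circle. The coefficients match by Pascal's rule. -/
lemma hasPeriodicWeakDeriv_leibniz {χ : ℝ → ℝ} {v : ℕ → ℝ → ℝ} (hχ : ContDiff ℝ ∞ χ)
    (hχc : HasCompactSupport χ) (hχs : tsupport χ ⊆ Ioo (-1) 1)
    (hv : ∀ k, MemLp (v k) 2 symVol) {r m : ℕ} (hm : m < r)
    (hder : ∀ k < r, HasWeakDeriv (-1) 1 1 (v k) (v (k + 1))) :
    HasPeriodicWeakDeriv (leibniz χ v m) (leibniz χ v (m + 1)) := by
  intro φ hφ _
  have key : ∀ (m : ℕ) (ψ : ℝ → ℝ), Continuous ψ → ∫ x, leibniz χ v m x * ψ x ∂symVol =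
      ∑ ij ∈ Finset.HasAntidiagonal.antidiagonal m, (m.choose ij.1 : ℝ) *
        ∫ x, iteratedDeriv ij.1 χ x * v ij.2 x * ψ x ∂symVol := fun m ψ hψ => by
    simp only [leibniz, Finset.sum_mul]
    have hi : ∀ ij : ℕ × ℕ, Integrable (fun x => iteratedDeriv ij.1 χ x * v ij.2 x * ψ x) symVol :=
      fun ij => MemLp.integrable_mul (memLp_mul_left (contDiff_iteratedDeriv hχ ij.1).continuous
        (hasCompactSupport_iteratedDeriv hχc ij.1) (hv ij.2)) (hψ.memLp_Ioo (-1) 1)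
    rw [integral_finsetSum]
    · refine Finset.sum_congr rfl fun ij _ => ?_
      rw [← integral_const_mul]
      exact integral_congr_ae (ae_of_all _ fun x => mul_assoc _ _ _)
    · intro ij _
      exact ((hi ij).const_mul (m.choose ij.1 : ℝ)).congr
        (ae_of_all _ fun x => (mul_assoc _ _ _).symm)
  rw [key m _ (hφ.continuous_deriv (by simp)), key (m + 1) _ hφ.continuous,
    Finset.sum_antidiagonal_choose_succ_mul
      (fun i j => ∫ x, iteratedDeriv i χ x * v j x * φ x ∂symVol), ← Finset.sum_add_distrib,
    ← Finset.sum_neg_distrib]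
  refine Finset.sum_congr rfl fun ij hij => ?_
  have hij' : ij.1 + ij.2 = m := Finset.HasAntidiagonal.mem_antidiagonal.1 hij
  rw [← Nat.choose_symm_of_eq_add hij'.symm,
    (hder ij.2 (by omega)).integral_mul_cutoff (hv _) (contDiff_iteratedDeriv hχ ij.1)
      (hasCompactSupport_iteratedDeriv hχc ij.1)
      ((tsupport_iteratedDeriv_subset χ ij.1).trans hχs) hφ, iteratedDeriv_succ]
  ring

/-- For `e = ε⁻¹ ≥ 1` the worst term is the one where all `r` derivatives fall on the cutoff, which
gives the power `e ^ r`. -/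
lemma abs_leibniz_le {χ : ℝ → ℝ} {v : ℕ → ℝ → ℝ} {r : ℕ} {B e : ℝ} (he : 1 ≤ e)
    (hB : ∀ i ≤ r, ∀ x, |iteratedDeriv i χ x| ≤ B * e ^ i) (x : ℝ) :
    |leibniz χ v r x| ≤ 2 ^ r * B * e ^ r * ∑ ij ∈ Finset.HasAntidiagonal.antidiagonal r, |v ij.2 x| := by
  have hB0 : 0 ≤ B := by simpa using (abs_nonneg _).trans (hB 0 (Nat.zero_le _) 0)
  rw [leibniz, Finset.mul_sum]
  refine (Finset.abs_sum_le_sum_abs _ _).trans (Finset.sum_le_sum fun ij hij => ?_)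
  have hij' : ij.1 + ij.2 = r := Finset.HasAntidiagonal.mem_antidiagonal.1 hij
  have h1 : (r.choose ij.1 : ℝ) ≤ 2 ^ r := by exact_mod_cast Nat.choose_le_two_pow r ij.1
  have h2 : |iteratedDeriv ij.1 χ x| ≤ B * e ^ r :=
    (hB _ (by omega) x).trans (by gcongr; omega)
  rw [abs_mul, abs_mul, Nat.abs_cast, mul_assoc (2 ^ r : ℝ), mul_assoc (2 ^ r : ℝ)]
  gcongr

lemma integral_sq_le_of_abs_le {α : Type*} [MeasurableSpace α] {μ : Measure α} {g V : α → ℝ}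
    (hV : MemLp V 2 μ) {c : ℝ} (h : ∀ x, |g x| ≤ c * V x) :
    ∫ x, g x ^ 2 ∂μ ≤ c ^ 2 * ∫ x, V x ^ 2 ∂μ := by
  rw [← integral_const_mul]
  refine integral_mono_of_nonneg (ae_of_all _ fun x => sq_nonneg _)
    (hV.integrable_sq.const_mul _) (ae_of_all _ fun x => ?_)
  change g x ^ 2 ≤ c ^ 2 * V x ^ 2
  rw [← sq_abs, ← mul_pow]
  exact pow_le_pow_left₀ (abs_nonneg _) (h x) 2

/-- An even Sobolev function can be modified within `ε` of the endpoints so that its cosine series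
converges fast. -/
lemma exists_modification {r : ℕ} (hr : 1 ≤ r) {u : ℝ → ℝ} (hu : MemSobolev (-1) 1 r u)
    (heven : ∀ x, u (-x) = u x) :
    ∃ (u' : ℝ → ℝ) (C : ℝ), 0 ≤ C ∧ MemLp u' 2 symVol ∧ HasWeakDeriv (-1) 1 1 u u' ∧
      ∀ ε ∈ Ioc (0 : ℝ) 1, ∃ h h' : ℝ → ℝ, MemLp h 2 symVol ∧ MemLp h' 2 symVol ∧
        (∀ x ∈ Ioo 0 (1 - ε), h x = u x) ∧ (∀ x ∈ Ioo 0 (1 - ε), h' x = u' x) ∧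
        ∫ x, (h x - u x) ^ 2 ∂symVol ≤ C ∧ ∫ x, (h' x - u' x) ^ 2 ∂symVol ≤ C * ε⁻¹ ^ 2 ∧
        ∀ K : ℕ, ∃ b : Fin K → ℝ,
          (K : ℝ) ^ (2 * r) * ∫ x, (h x - cosSum b x) ^ 2 ∂symVol ≤ C * ε⁻¹ ^ (2 * r) ∧
          (K : ℝ) ^ (2 * (r - 1)) * ∫ x, (h' x - cosSumDeriv b x) ^ 2 ∂symVol ≤
            C * ε⁻¹ ^ (2 * r) := by
  obtain ⟨v, hv0, hv, hvd⟩ := hu.exists_derivs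
  obtain ⟨B, hB0, hB⟩ := exists_cutoff r
  set V : ℝ → ℝ := fun x => ∑ ij ∈ Finset.HasAntidiagonal.antidiagonal r, |v ij.2 x|
  have hV : MemLp V 2 symVol := memLp_finsetSum _ fun ij _ => (hv ij.2).abs
  set V1 : ℝ → ℝ := fun x => |v 1 x| + |u x|
  have hV1 : MemLp V1 2 symVol := (hv 1).abs.add hu.1.abs
  set I := ∫ x, V x ^ 2 ∂symVol
  set I1 := ∫ x, V1 x ^ 2 ∂symVol
  have hI : 0 ≤ I := integral_nonneg fun _ => sq_nonneg _
  have hI1 : 0 ≤ I1 := integral_nonneg fun _ => sq_nonneg _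
  -- The constant adds up two bounds: the first summand controls the `r`-th derivative of `χ u`, the
  -- second the change `χ u - u` and its derivative. Neither depends on `ε`.
  refine ⟨v 1, (2 ^ r * B) ^ 2 * I + (B + 1) ^ 2 * I1, by positivity, hv 1, hvd 1 hr,
    fun ε hε => ?_⟩
  have hinv : 1 ≤ ε⁻¹ := (one_le_inv₀ hε.1).2 hε.2
  obtain ⟨χ, hχ, hχc, hχs, hχe, hχ1, hχB⟩ := hB ε hε
  have hW0 : ∀ x, leibniz χ v 0 x = χ x * u x := fun x => by simp [leibniz, hv0]
  have hW1 : ∀ x, leibniz χ v 1 x = χ x * v 1 x + deriv χ x * u x := fun x => by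
    simp [leibniz, Finset.Nat.antidiagonal_succ, hv0]
  have hW := memLp_leibniz hχ hχc hv
  have hχ0 : ∀ x, |χ x - 1| ≤ B + 1 := fun x => by
    have := hχB 0 (Nat.zero_le _) x
    simp only [iteratedDeriv_zero, pow_zero, mul_one] at this
    exact (abs_sub _ _).trans (by simpa using this)
  have hχ' : ∀ x, |deriv χ x| ≤ B * ε⁻¹ := fun x => by simpa using hχB 1 hr x
  have hWr : ∫ x, leibniz χ v r x ^ 2 ∂symVol ≤
      ((2 ^ r * B) ^ 2 * I + (B + 1) ^ 2 * I1) * ε⁻¹ ^ (2 * r) := by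
    refine (integral_sq_le_of_abs_le hV (fun x => abs_leibniz_le hinv hχB x)).trans ?_
    have : (2 ^ r * B * ε⁻¹ ^ r) ^ 2 * I = (2 ^ r * B) ^ 2 * I * ε⁻¹ ^ (2 * r) := by ring
    rw [this]
    gcongr
    exact le_add_of_nonneg_right (by positivity)
  -- The modification is `χ u`, together with `χ u' + χ' u`.
  refine ⟨leibniz χ v 0, leibniz χ v 1, hW 0, hW 1, fun x hx => ?_, fun x hx => ?_, ?_, ?_,
    fun K => ?_⟩
  · rw [hW0, hχ1 x hx, one_mul]
  · have : χ =ᶠ[nhds x] fun _ => 1 :=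
      Filter.eventuallyEq_of_mem (Ioo_mem_nhds hx.1 hx.2) hχ1
    rw [hW1, hχ1 x hx, this.deriv_eq, deriv_const, one_mul, zero_mul, add_zero]
  · refine (integral_sq_le_of_abs_le hV1 (c := B + 1) fun x => ?_).trans
      (le_add_of_nonneg_left (by positivity))
    rw [hW0, ← sub_one_mul, abs_mul]
    have := hχ0 x
    gcongr
    exact le_add_of_nonneg_left (abs_nonneg _)
  · refine (integral_sq_le_of_abs_le hV1 (c := (B + 1) * ε⁻¹) fun x => ?_).trans ?_
    · have e : leibniz χ v 1 x - v 1 x = (χ x - 1) * v 1 x + deriv χ x * u x := by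
        rw [hW1]; ring
      rw [e]
      refine (abs_add_le _ _).trans ?_
      rw [abs_mul, abs_mul, mul_add]
      have h1 : |χ x - 1| ≤ (B + 1) * ε⁻¹ :=
        (hχ0 x).trans (le_mul_of_one_le_right (by positivity) hinv)
      have h2 : |deriv χ x| ≤ (B + 1) * ε⁻¹ := (hχ' x).trans (by gcongr; linarith)
      gcongr
    · rw [mul_pow, mul_right_comm]
      gcongr
      exact le_add_of_nonneg_left (by positivity)
  · obtain ⟨b, hb, hb'⟩ := exists_cosSum_approx hr hW
      (fun j hj => hasPeriodicWeakDeriv_leibniz hχ hχc hχs hv hj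
        fun k hk => (hvd k hk.le).succ (hvd (k + 1) hk))
      (fun x => by rw [hW0, hW0, hχe, heven]) K
    exact ⟨b, hb.trans hWr, hb'.trans hWr⟩

/-! ### Error of the trial sum and balancing -/

lemma unitVol_le_symVol : unitVol ≤ symVol :=
  Measure.restrict_mono (Ioo_subset_Ioo (by norm_num) le_rfl) le_rfl

lemma integral_sq_unitVol_le {g : ℝ → ℝ} (hg : MemLp g 2 symVol) :
    ∫ x, g x ^ 2 ∂unitVol ≤ ∫ x, g x ^ 2 ∂symVol :=
  integral_mono_measure unitVol_le_symVol (ae_of_all _ fun _ => sq_nonneg _) hg.integrable_sq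

lemma HasWeakDeriv.mono {a b a' b' : ℝ} {k : ℕ} {u v : ℝ → ℝ} (h : HasWeakDeriv a b k u v)
    (hs : Ioo a' b' ⊆ Ioo a b) : HasWeakDeriv a' b' k u v := by
  refine ⟨h.1.mono_set hs, h.2.1.mono_set hs, fun φ hφ hφc hφs => ?_⟩
  have e := h.2.2 φ hφ hφc (hφs.trans hs)
  have hsi := tsupport_iteratedDeriv_subset φ k
  rwa [setIntegral_mul_eq_integral_of_tsupport_subset (hφs.trans hs),
    ← setIntegral_mul_eq_integral_of_tsupport_subset hφs,
    setIntegral_mul_eq_integral_of_tsupport_subset (hsi.trans (hφs.trans hs)),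
    ← setIntegral_mul_eq_integral_of_tsupport_subset (hsi.trans hφs)] at e

/-- The `L²` bound for averages with a weight dominated by `density d`, applied to functions
supported within `ε` of `1`. -/
lemma integral_dilAvg_sq_le_of_support {d : ℕ} (hd : 3 ≤ d) {w g : ℝ → ℝ} (hw : Measurable w)
    (hwb : ∀ δ t : ℝ, 0 ≤ δ → t ∈ Ioo δ 1 →
      |w t| ≤ normConst d * (2 * (1 - δ)) ^ (((d : ℝ) - 3) / 2))
    (hg : MemLp g 2 unitVol) {ε : ℝ} (hε : ε ∈ Ioc (0 : ℝ) 1)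
    (hg0 : ∀ x ∈ Ioo 0 (1 - ε), g x = 0) :
    ∫ s, dilAvg w g s ^ 2 ∂unitVol ≤
      normConst d ^ 2 * (2 * ε) ^ (d - 1) * ∫ x, g x ^ 2 ∂unitVol := by
  have hδ : 0 ≤ 1 - ε := by linarith [hε.2]
  have h2ε : 0 ≤ 2 * ε := by linarith [hε.1]
  -- The choice `J = 2ε` is valid because `√x ≥ x` on `[0,1]`.
  have h := integral_dilAvg_sq_le hw (fun t ht => hwb 0 t le_rfl ht) hg hδ (by linarith [hε.1])
    (fun t ht => hwb (1 - ε) t hδ ht) hg0 (J := 2 * ε) (by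
      have := Real.rpow_le_rpow_of_exponent_ge' hδ (by linarith [hε.1])
        (by norm_num : (0 : ℝ) ≤ 1 / 2) (by norm_num : (1 / 2 : ℝ) ≤ 1)
      rw [Real.rpow_one] at this
      linarith)
  refine h.trans (le_of_eq ?_)
  congr 1
  -- The half-integer exponent disappears on squaring: `2ε` to the power `d - 3` from the weight and
  -- a factor `(2ε)²` from `J` make `(2ε)^(d-1)`.
  obtain ⟨D, rfl⟩ : ∃ D, d = D + 3 := ⟨d - 3, by omega⟩
  have e1 : ((2 * ε) ^ ((((D + 3 : ℕ) : ℝ) - 3) / 2)) ^ 2 = (2 * ε) ^ D := by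
    rw [← Real.rpow_natCast (_ ^ _), ← Real.rpow_mul h2ε, ← Real.rpow_natCast]
    congr 1
    push_cast
    ring
  rw [show (1 : ℝ) - (1 - ε) = ε by ring, mul_pow, mul_pow, e1, show D + 3 - 1 = D + 2 by omega]
  ring

lemma integral_add_sq_le {α : Type*} [MeasurableSpace α] {μ : Measure α} {u v : α → ℝ}
    (hu : MemLp u 2 μ) (hv : MemLp v 2 μ) :
    ∫ x, (u x + v x) ^ 2 ∂μ ≤ 2 * ∫ x, u x ^ 2 ∂μ + 2 * ∫ x, v x ^ 2 ∂μ := by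
  rw [← integral_const_mul, ← integral_const_mul,
    ← integral_add (hu.integrable_sq.const_mul _) (hv.integrable_sq.const_mul _)]
  refine integral_mono (hu.add hv).integrable_sq
    ((hu.integrable_sq.const_mul _).add (hv.integrable_sq.const_mul _)) fun x => ?_
  change (u x + v x) ^ 2 ≤ 2 * u x ^ 2 + 2 * v x ^ 2
  nlinarith [sq_nonneg (u x - v x)]

/-- For the truncation error `g` no localization is available, so it is bounded with `ε = 1`; only
the modification error `g'` gains the power of `ε`. -/
lemma integral_dilAvg_add_sq_le {d : ℕ} (hd : 3 ≤ d) {w g g' : ℝ → ℝ} (hw : Measurable w)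
    (hwb : ∀ δ t : ℝ, 0 ≤ δ → t ∈ Ioo δ 1 →
      |w t| ≤ normConst d * (2 * (1 - δ)) ^ (((d : ℝ) - 3) / 2))
    (hg : MemLp g 2 unitVol) (hg' : MemLp g' 2 unitVol) {ε : ℝ} (hε : ε ∈ Ioc (0 : ℝ) 1)
    (hg0 : ∀ x ∈ Ioo 0 (1 - ε), g' x = 0) :
    ∫ s, dilAvg w (fun x => g x + g' x) s ^ 2 ∂unitVol ≤ 2 * normConst d ^ 2 * 2 ^ (d - 1) *
      (∫ x, g x ^ 2 ∂unitVol + ε ^ (d - 1) * ∫ x, g' x ^ 2 ∂unitVol) := by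
  have hM := fun t ht => hwb 0 t le_rfl ht
  have h1 := integral_dilAvg_sq_le_of_support hd hw hwb hg (ε := 1) (by simp) (by simp)
  have h2 := integral_dilAvg_sq_le_of_support hd hw hwb hg' hε hg0
  have e : ∫ s, dilAvg w (fun x => g x + g' x) s ^ 2 ∂unitVol =
      ∫ s, (dilAvg w g s + dilAvg w g' s) ^ 2 ∂unitVol :=
    setIntegral_congr_fun measurableSet_Ioo fun s hs => by
      simp only [dilAvg_add hw hM hg hg' hs]
  rw [e]
  refine (integral_add_sq_le (memLp_dilAvg hw hM hg) (memLp_dilAvg hw hM hg')).trans ?_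
  rw [mul_one] at h1
  rw [mul_pow] at h2
  linarith

/-- Trial coefficients with an error depending on the width `ε` of the modified zone. -/
lemma exists_trial {d : ℕ} (hd : 3 ≤ d) {r : ℕ} (hr : 1 ≤ r) {u : ℝ → ℝ}
    (hu : MemSobolev (-1) 1 r u) (heven : ∀ x, u (-x) = u x) :
    ∃ (u' : ℝ → ℝ) (C : ℝ), 0 ≤ C ∧ MemLp u' 2 unitVol ∧ HasWeakDeriv 0 1 1 u u' ∧
      ∀ (K : ℕ), 1 ≤ K → ∀ ε ∈ Ioc (0 : ℝ) 1, ∃ b : Fin K → ℝ,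
        ∫ s, (slicing d (cosSum b) s - slicing d u s) ^ 2 ∂unitVol ≤
          C * (ε⁻¹ ^ (2 * r) / K ^ (2 * r) + ε ^ (d - 1)) ∧
        ∫ s, (dilAvg (fun t => t * density d t) (cosSumDeriv b) s -
            dilAvg (fun t => t * density d t) u' s) ^ 2 ∂unitVol ≤
          C * (ε⁻¹ ^ (2 * r) / K ^ (2 * (r - 1)) + ε ^ (d - 3)) := by
  obtain ⟨u', C, hC, hu', huu', H⟩ := exists_modification hr hu heven
  have hsub : Ioo (0 : ℝ) 1 ⊆ Ioo (-1) 1 := Ioo_subset_Ioo (by norm_num) le_rfl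
  have hmono : ∀ {g : ℝ → ℝ}, MemLp g 2 symVol → MemLp g 2 unitVol := fun hg =>
    hg.mono_measure unitVol_le_symVol
  set Q := 2 * normConst d ^ 2 * 2 ^ (d - 1)
  have hQ : 0 ≤ Q := by positivity
  refine ⟨u', Q * C, mul_nonneg hQ hC, hmono hu', huu'.mono hsub, fun K hK ε hε => ?_⟩
  have hK0 : (0 : ℝ) < K := by exact_mod_cast hK
  have hε0 := hε.1
  obtain ⟨h, h', hh, hh', hhu, hhu', hb1, hb2, hb⟩ := H ε hε
  obtain ⟨b, hb3, hb4⟩ := hb K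
  have hs := (continuous_cosSum b).memLp_Ioo (-1) 1
  have hs' := (continuous_cosSumDeriv b).memLp_Ioo (-1) 1
  -- One estimate for functions and derivatives alike: `s` is the cosine sum, `g` the target, `k`
  -- the modification between them.
  have main : ∀ {w s g k : ℝ → ℝ} {A B : ℝ}, Measurable w →
      (∀ δ t : ℝ, 0 ≤ δ → t ∈ Ioo δ 1 →
        |w t| ≤ normConst d * (2 * (1 - δ)) ^ (((d : ℝ) - 3) / 2)) →
      MemLp s 2 symVol → MemLp g 2 symVol → MemLp k 2 symVol →
      (∀ x ∈ Ioo 0 (1 - ε), k x = g x) → ∫ x, (k x - s x) ^ 2 ∂symVol ≤ A →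
      ∫ x, (k x - g x) ^ 2 ∂symVol ≤ B →
      ∫ y, (dilAvg w s y - dilAvg w g y) ^ 2 ∂unitVol ≤ Q * (A + ε ^ (d - 1) * B) := by
    intro w s g k A B hw hwb ms mg mk hkg hA hB
    have hM := fun t ht => hwb 0 t le_rfl ht
    have e : ∫ y, (dilAvg w s y - dilAvg w g y) ^ 2 ∂unitVol =
        ∫ y, dilAvg w (fun x => (s x - k x) + (k x - g x)) y ^ 2 ∂unitVol :=
      setIntegral_congr_fun measurableSet_Ioo fun y hy => by
        simp only [sub_add_sub_cancel, dilAvg_sub hw hM (hmono ms) (hmono mg) hy]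
    rw [e]
    refine (integral_dilAvg_add_sq_le hd hw hwb (hmono (ms.sub mk)) (hmono (mk.sub mg)) hε
      fun x hx => sub_eq_zero.2 (hkg x hx)).trans ?_
    have i1 : ∫ x, (s x - k x) ^ 2 ∂unitVol ≤ A := by
      refine (integral_sq_unitVol_le (ms.sub mk)).trans (le_trans (le_of_eq ?_) hA)
      exact integral_congr_ae (ae_of_all _ fun x => by
        change (s x - k x) ^ 2 = (k x - s x) ^ 2
        ring)
    have i2 : ∫ x, (k x - g x) ^ 2 ∂unitVol ≤ B := (integral_sq_unitVol_le (mk.sub mg)).trans hB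
    gcongr
    exacts [i1, i2]
  refine ⟨b, ?_, ?_⟩
  · refine (main (measurable_density d) (fun δ t hδ ht => abs_density_le hd hδ ht) hs hu.1 hh hhu
      (A := C * ε⁻¹ ^ (2 * r) / K ^ (2 * r)) ?_ hb1).trans (le_of_eq (by ring))
    rwa [le_div_iff₀ (by positivity), mul_comm]
  · refine (main (measurable_id.mul (measurable_density d))
      (fun δ t hδ ht => abs_mul_density_le hd hδ ht) hs' hu' hh' hhu'
      (A := C * ε⁻¹ ^ (2 * r) / K ^ (2 * (r - 1))) ?_ hb2).trans (le_of_eq ?_)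
    · rwa [le_div_iff₀ (by positivity), mul_comm]
    -- The derivative of the cutoff costs `ε⁻²`, which lowers the exponent from `d - 1` to `d - 3`.
    · have : ε ^ (d - 1) * (C * ε⁻¹ ^ 2) = C * ε ^ (d - 3) := by
        rw [show d - 1 = d - 3 + 2 by omega, pow_add]
        field_simp
      rw [this]
      ring

/-- Balancing the two error terms. -/
lemma le_rpow_of_balance {N C : ℝ} (hC : 0 ≤ C) {K r p q : ℕ} (hK : 1 ≤ K) (hr : 1 ≤ r)
    (h : ∀ ε ∈ Ioc (0 : ℝ) 1, N ^ 2 ≤ C * (ε⁻¹ ^ (2 * r) / K ^ (2 * p) + ε ^ q)) :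
    N ≤ Real.sqrt (2 * C) * (K : ℝ) ^ (-((p : ℝ) * q / (q + 2 * r))) := by
  have hK0 : (0 : ℝ) < K := by exact_mod_cast hK
  have hK1 : (1 : ℝ) ≤ K := by exact_mod_cast hK
  have hr0 : (0 : ℝ) < r := by exact_mod_cast hr
  have hqr : (0 : ℝ) < q + 2 * r := by positivity
  -- With `ε = K^(-θ)` both terms agree: `ε^(q + 2r) = K^(-2p)`.
  set θ : ℝ := 2 * p / (q + 2 * r)
  have hθ : 0 ≤ θ := by positivity
  have hε : (K : ℝ) ^ (-θ) ∈ Ioc (0 : ℝ) 1 :=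
    ⟨by positivity, Real.rpow_le_one_of_one_le_of_nonpos hK1 (by linarith)⟩
  have h1 := h _ hε
  have e1 : ((K : ℝ) ^ (-θ))⁻¹ ^ (2 * r) / (K : ℝ) ^ (2 * p) = (K : ℝ) ^ (-(θ * q)) := by
    rw [← Real.rpow_neg hK0.le, neg_neg, ← Real.rpow_natCast, ← Real.rpow_mul hK0.le,
      ← Real.rpow_natCast, ← Real.rpow_sub hK0]
    congr 1
    simp only [θ]
    push_cast
    field_simp
    ring
  have e2 : ((K : ℝ) ^ (-θ)) ^ q = (K : ℝ) ^ (-(θ * q)) := by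
    rw [← Real.rpow_natCast, ← Real.rpow_mul hK0.le, neg_mul]
  rw [e1, e2] at h1
  refine le_of_abs_le (abs_le_of_sq_le_sq ?_ (by positivity))
  rw [mul_pow, Real.sq_sqrt (by positivity), ← Real.rpow_natCast (_ ^ _), ← Real.rpow_mul hK0.le]
  have e3 : -((p : ℝ) * q / (q + 2 * r)) * (2 : ℕ) = -(θ * q) := by
    simp only [θ]
    push_cast
    field_simp
  rw [e3]
  linarith

end Slicing

/-! ### Comparing the minimizer with the trial sum -/

theorem proposition5p4 (d : ℕ) (hd : 3 ≤ d) (r : ℕ) (hr : 1 ≤ r) (f F : ℝ → ℝ)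
    (hf : Slicing.MemSobolev (-1) 1 r (fun x => f |x|))
    (hF : ∀ᵐ s ∂(volume.restrict (Set.Icc (0 : ℝ) 1)), F s = Slicing.slicing d f s) :
    (∃ C : ℝ, 0 < C ∧ ∀ K : ℕ, 1 ≤ K →
      (∃! a : Fin K → ℝ, Slicing.IsMinimizer Slicing.l2Norm d F a) ∧
      ∀ a : Fin K → ℝ, Slicing.IsMinimizer Slicing.l2Norm d F a →
        MemLp (fun s => F s - Slicing.slicing d (Slicing.cosSum a) s) 2
          (volume.restrict (Set.Icc (0 : ℝ) 1)) ∧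
        Slicing.l2Norm (fun s => F s - Slicing.slicing d (Slicing.cosSum a) s) ≤
          C * (K : ℝ) ^ (-((r : ℝ) / (1 + 2 * (r : ℝ) / ((d : ℝ) - 1))))) ∧
    (∃ C : ℝ, 0 < C ∧ ∀ K : ℕ, 1 ≤ K →
      (∃! a : Fin K → ℝ, Slicing.IsMinimizer Slicing.h1Norm d F a) ∧
      ∀ a : Fin K → ℝ, Slicing.IsMinimizer Slicing.h1Norm d F a →
        Slicing.MemSobolev 0 1 1 (fun s => F s - Slicing.slicing d (Slicing.cosSum a) s) ∧
        Slicing.h1Norm (fun s => F s - Slicing.slicing d (Slicing.cosSum a) s) ≤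
          C * (K : ℝ) ^ (-(((r : ℝ) - 1) * ((d : ℝ) - 3) / ((d : ℝ) - 3 + 2 * (r : ℝ))))) := by
  open Slicing in
  -- Slicing on `(0,1)` uses only values on `(0,1)`, where `f` and `u` agree.
  set u : ℝ → ℝ := fun x => f |x|
  obtain ⟨u', C, hC, hu', huu', H⟩ := exists_trial hd hr hf (fun x => by simp [u])
  have hu : MemLp u 2 unitVol := hf.1.mono_measure unitVol_le_symVol
  have hFu : F =ᵐ[unitVol] slicing d u := by
    filter_upwards [ae_restrict_of_ae_restrict_of_subset Set.Ioo_subset_Icc_self hF,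
      ae_restrict_mem measurableSet_Ioo] with s hs hs'
    rw [hs]
    refine dilAvg_congr ?_ hs'
    filter_upwards [ae_restrict_mem measurableSet_Ioo] with x hx
    simp only [u, abs_of_pos hx.1]
  have hFm : MemLp F 2 unitVol := (memLp_slicing hd hu).ae_eq hFu.symm
  set G := dilAvg (fun t => t * density d t) u'
  have hG : MemLp G 2 unitVol := memLp_dilAvg_mul_density hd hu'
  obtain ⟨M, hM, -⟩ := exists_abs_density_le hd
  have hFG : HasWeakDeriv 0 1 1 F G :=
    (hasWeakDeriv_dilAvg (measurable_density d) hM hu hu' huu').congr_left hFm hFu.symm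
  have hFsub : ∀ {K : ℕ} (a : Fin K → ℝ),
      MemLp (fun s => F s - slicing d (cosSum a) s) 2 unitVol := fun a =>
    hFm.sub (memLp_slicing hd ((continuous_cosSum a).memLp_Ioo 0 1))
  have hGsub : ∀ {K : ℕ} (a : Fin K → ℝ), MemLp (fun s => G s -
      dilAvg (fun t => t * density d t) (cosSumDeriv a) s) 2 unitVol := fun a =>
    hG.sub (memLp_dilAvg_mul_density hd ((continuous_cosSumDeriv a).memLp_Ioo 0 1))
  have hFGsub : ∀ {K : ℕ} (a : Fin K → ℝ), HasWeakDeriv 0 1 1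
      (fun s => F s - slicing d (cosSum a) s)
      (fun s => G s - dilAvg (fun t => t * density d t) (cosSumDeriv a) s) := fun a =>
    hFG.sub (hasWeakDeriv_slicing_cosSum hd a) hFm hG
      (memLp_slicing hd ((continuous_cosSum a).memLp_Ioo 0 1))
      (memLp_dilAvg_mul_density hd ((continuous_cosSumDeriv a).memLp_Ioo 0 1))
  have hl2 : ∀ {K : ℕ} (b : Fin K → ℝ), l2Norm (fun s => slicing d (cosSum b) s - F s) ^ 2 =
      ∫ s, (slicing d (cosSum b) s - slicing d u s) ^ 2 ∂unitVol := fun b => by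
    rw [l2Norm_sq]
    exact integral_congr_ae (hFu.mono fun s hs => by simp only [hs])
  have hh1 : ∀ {K : ℕ} (b : Fin K → ℝ), h1Norm (fun s => slicing d (cosSum b) s - F s) ^ 2 =
      (∫ s, (slicing d (cosSum b) s - slicing d u s) ^ 2 ∂unitVol) +
      ∫ s, (dilAvg (fun t => t * density d t) (cosSumDeriv b) s - G s) ^ 2 ∂unitVol := fun b => by
    rw [h1Norm_sq (hasWeakDeriv_slicing_cosSum_sub hd hFm hG hFG b), ← l2Norm_sq, hl2]
  have hl2c : ∀ {K : ℕ} (a : Fin K → ℝ), l2Norm (fun s => F s - slicing d (cosSum a) s) =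
      l2Norm (fun s => slicing d (cosSum a) s - F s) := fun a => by
    unfold l2Norm
    simp only [sub_sq_comm (F _)]
  have hh1c : ∀ {K : ℕ} (a : Fin K → ℝ), h1Norm (fun s => F s - slicing d (cosSum a) s) ^ 2 =
      h1Norm (fun s => slicing d (cosSum a) s - F s) ^ 2 := fun a => by
    rw [h1Norm_sq (hFGsub a), h1Norm_sq (hasWeakDeriv_slicing_cosSum_sub hd hFm hG hFG a)]
    simp only [sub_sq_comm (F _), sub_sq_comm (G _)]
  have hd' : (3 : ℝ) ≤ d := by exact_mod_cast hd
  have hr' : (1 : ℝ) ≤ r := by exact_mod_cast hr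
  -- The added `1` keeps the constants positive if `C = 0`. The extra factor `2` for `H¹` absorbs
  -- the `L²` part of the norm.
  refine ⟨⟨Real.sqrt (2 * C) + 1, by positivity, fun K hK =>
    ⟨existsUnique_isMinimizer_l2Norm hd hFm K, fun a ha => ⟨?_, ?_⟩⟩⟩,
    ⟨Real.sqrt (2 * (2 * C)) + 1, by positivity, fun K hK =>
    ⟨existsUnique_isMinimizer_h1Norm hd hFm hG hFG K, fun a ha => ⟨?_, ?_⟩⟩⟩⟩
  · rw [Measure.restrict_congr_set Ioo_ae_eq_Icc.symm]
    exact hFsub a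
  · have key := le_rpow_of_balance (N := l2Norm (fun s => F s - slicing d (cosSum a) s)) hC
      (p := r) (q := d - 1) hK hr fun ε hε => by
        obtain ⟨b, hb, -⟩ := H K hK ε hε
        rw [hl2c]
        exact (ha b).trans ((hl2 b).trans_le hb)
    have e : (r : ℝ) * ((d - 1 : ℕ) : ℝ) / (((d - 1 : ℕ) : ℝ) + 2 * r) =
        r / (1 + 2 * r / ((d : ℝ) - 1)) := by
      rw [Nat.cast_sub (by omega), Nat.cast_one]
      have : (d : ℝ) - 1 ≠ 0 := by linarith
      field_simp
    rw [e] at key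
    refine key.trans ?_
    gcongr
    linarith
  · refine ⟨hFsub a, fun k hk => ?_⟩
    rcases Nat.le_one_iff_eq_zero_or_eq_one.1 hk with rfl | rfl
    · exact ⟨_, hFsub a, locallyIntegrableOn_of_memLp (hFsub a),
        locallyIntegrableOn_of_memLp (hFsub a), fun φ _ _ _ => by simp⟩
    · exact ⟨_, hGsub a, hFGsub a⟩
  -- Since `ε ≤ 1 ≤ K`, the bound for the derivative dominates the one for the function, so the
  -- exponents `r - 1` and `d - 3` decide.
  · have key := le_rpow_of_balance (N := h1Norm (fun s => F s - slicing d (cosSum a) s))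
      (C := 2 * C) (by positivity) (p := r - 1) (q := d - 3) hK hr fun ε hε => by
        obtain ⟨b, hb, hb'⟩ := H K hK ε hε
        rw [hh1c]
        refine (ha b).trans ((hh1 b).trans_le ((add_le_add hb hb').trans ?_))
        have hK1 : (1 : ℝ) ≤ K := by exact_mod_cast hK
        have hε0 := hε.1
        have i1 : ε⁻¹ ^ (2 * r) / (K : ℝ) ^ (2 * r) ≤ ε⁻¹ ^ (2 * r) / (K : ℝ) ^ (2 * (r - 1)) := by
          gcongr
          omega
        have i2 : ε ^ (d - 1) ≤ ε ^ (d - 3) := pow_le_pow_of_le_one hε.1.le hε.2 (by omega)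
        have i3 := mul_le_mul_of_nonneg_left (add_le_add i1 i2) hC
        linarith
    have e : ((r - 1 : ℕ) : ℝ) * ((d - 3 : ℕ) : ℝ) / (((d - 3 : ℕ) : ℝ) + 2 * r) =
        ((r : ℝ) - 1) * ((d : ℝ) - 3) / ((d : ℝ) - 3 + 2 * r) := by
      rw [Nat.cast_sub hd, Nat.cast_sub hr]
      norm_num
    rw [e] at key
    refine key.trans ?_
    gcongr
    linarith
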